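/- Let $S$ be a set, $\Sigma$ an ultrafilter on $S$, $(F_i)_{i\in S}$ a family of fields, and $F=\prod_{i\in S}F_i/\Sigma$ their ultraproduct (families are identified when they agree on a set of indices in $\Sigma$). "Almost every $i$" means: for all $i$ in some set belonging to $\Sigma$. Fix $n\ge 0$ and $P\in\mathbb{Q}[t]$. For a closed subscheme $X\subset\mathbb{P}^n_K$ over a field $K$, let $I(X)\subset K[x_0,\dots,x_n]$ be its homogeneous ideal, generated by the homogeneous polynomials vanishing on $X$; $X$ has Hilbert polynomial $P$ if $\dim_K (K[x_0,\dots,x_n]/I(X))_d=P(d)$ for all sufficiently large $d$. (1) Let $X\subset\mathbb{P}^n_F$ be a closed subscheme with Hilbert polynomial $P$. Let $f_1,\dots,f_r$ be homogeneous polynomials over $F$ that cut out $X$. Choose representatives in $\prod_{i} F_i$ of the coefficients of the $f_j$, let $f_j^{i}$ be the homogeneous polynomial over $F_i$, of the same degree as $f_j$, formed from the $i$-th entries, and let $X_i\subset\mathbb{P}^n_{F_i}$ be the closed subscheme cut out by $f_1^i,\dots,f_r^i$. Then for every such choice of the $f_j$ and of the representatives, $X_i$ has Hilbert polynomial $P$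 for almost every $i$. (2) Conversely, let $X_i\subset\mathbb{P}^n_{F_i}$ ($i\in S$) be closed subschemes such that $X_i$ has Hilbert polynomial $P$ for almost every $i$. Put $J_d=\prod_{i}I(X_i)_d/\Sigma\subset F[x_0,\dots,x_n]_d$ and $J=\bigoplus_d J_d$, a homogeneous ideal of $F[x_0,\dots,x_n]$, and let $\prod_i X_i/\Sigma$ be the closed subscheme of $\mathbb{P}^n_F$ defined by $J$. Then $\prod_i X_i/\Sigma$ has Hilbert polynomial $P$. If moreover almost every $X_i$ is an integral scheme, then so is $\prod_i X_i/\Sigma$. -/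

import Mathlib

open AlgebraicGeometry MvPolynomial

noncomputable section

namespace UltraHilb

/-! ### Ultraproducts of rings -/

section Ultraproduct

variable {S : Type*} (U : Ultrafilter S) (F : S → Type*) [∀ i, CommRing (F i)]

/-- The ideal of families `(a i)` that vanish for almost every `i`. -/
def ultraIdeal : Ideal (∀ i, F i) where
  carrier := {a | ∀ᶠ i in (U : Filter S), a i = 0}
  zero_mem' := by simp
  add_mem' := by
    intro a b ha hb
    filter_upwards [ha, hb] with i h1 h2
    simp [h1, h2]
  smul_mem' := by
    intro c a ha
    filter_upwards [ha] with i h1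
    simp [h1]

/-- The ultraproduct of the rings `F i`: two families are identified when they agree for almost
every `i`. -/
abbrev Ultraproduct : Type _ := (∀ i, F i) ⧸ ultraIdeal U F

/-- The class of a family in the ultraproduct. -/
abbrev ultraMk : (∀ i, F i) →+* Ultraproduct U F := Ideal.Quotient.mk (ultraIdeal U F)

end Ultraproduct

/-- An ultraproduct of fields is a field. -/
instance ultraIdeal_isMaximal {S : Type*} (U : Ultrafilter S) (F : S → Type*)
    [∀ i, Field (F i)] : (ultraIdeal U F).IsMaximal := by
  classical
  rw [Ideal.isMaximal_iff]
  constructor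
  · intro h
    have h' : ∀ᶠ i in (U : Filter S), (1 : ∀ i, F i) i = 0 := h
    obtain ⟨i, hi⟩ := h'.exists
    exact one_ne_zero hi
  · intro J a _ ha haJ
    have hne : ∀ᶠ i in (U : Filter S), a i ≠ 0 := Ultrafilter.eventually_not.mpr ha
    have hmem : (1 : ∀ i, F i) - (fun i => (a i)⁻¹) * a ∈ ultraIdeal U F := by
      change ∀ᶠ i in (U : Filter S), _
      filter_upwards [hne] with i hi
      simp [hi]
    have := J.add_mem (‹ultraIdeal U F ≤ J› hmem) (J.mul_mem_left (fun i => (a i)⁻¹) haJ)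
    simpa using this

/-! ### Closed subschemes of projective space -/

section Projective

variable (n : ℕ) (R : Type*) [CommRing R]

/-- The grading of `R[x₀, …, xₙ]` by degree. -/
abbrev grading : ℕ → Submodule R (MvPolynomial (Fin (n + 1)) R) :=
  homogeneousSubmodule (Fin (n + 1)) R

instance gradingGraded : GradedAlgebra (grading n R) := MvPolynomial.gradedAlgebra

/-- Projective space `ℙⁿ` over `R`. -/
abbrev ProjectiveSpace : Scheme := Proj (grading n R)

/-- A closed subscheme of `ℙⁿ`, given by its quasi-coherent sheaf of ideals; the scheme itself is
`X.subscheme`, with closed immersion `X.subschemeι`. Smaller ideal sheaves are larger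
subschemes. -/
abbrev ClosedSubscheme : Type _ := (ProjectiveSpace n R).IdealSheafData

variable {n R}

theorem X_mem_grading (k : Fin (n + 1)) :
    (X k : MvPolynomial (Fin (n + 1)) R) ∈ grading n R 1 := isHomogeneous_X R k

/-- The standard affine chart `D₊(xₖ)`. -/
abbrev chart (k : Fin (n + 1)) : (ProjectiveSpace n R).affineOpens :=
  ⟨Proj.basicOpen (grading n R) (X k),
    Proj.isAffineOpen_basicOpen (grading n R) (X k) (X_mem_grading k) one_pos⟩

/-- The degree zero part of `R[x₀, …, xₙ]` localised at `xₖ`. -/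
abbrev ChartRing (n : ℕ) (R : Type*) [CommRing R] (k : Fin (n + 1)) : Type _ :=
  HomogeneousLocalization.Away (grading n R) (X k)

/-- The fraction `xⱼ / xₖ`. -/
def chartCoord (k j : Fin (n + 1)) : ChartRing n R k :=
  HomogeneousLocalization.Away.mk (grading n R) (X_mem_grading k) 1 (X j)
    (by simpa using X_mem_grading j)

/-- The structure map from the base ring to the chart ring. -/
def chartScalar (k : Fin (n + 1)) : R →+* ChartRing n R k :=
  (HomogeneousLocalization.fromZeroRingHom (grading n R) (.powers (X k))).comp
    (algebraMap R (grading n R 0))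

/-- Dehomogenisation: the ring homomorphism with `xⱼ ↦ xⱼ / xₖ`, which sends a homogeneous `f` of
degree `d` to `f / xₖ ^ d`. -/
def dehomogenize (k : Fin (n + 1)) : MvPolynomial (Fin (n + 1)) R →+* ChartRing n R k :=
  eval₂Hom (chartScalar k) (chartCoord k)

/-- Dehomogenisation, with values in the functions on the chart `D₊(xₖ)` of `ℙⁿ`. -/
def toChart (k : Fin (n + 1)) :
    MvPolynomial (Fin (n + 1)) R →+* Γ(ProjectiveSpace n R, (chart k).1) :=
  (Proj.awayToSection (grading n R) (X k)).hom.comp (dehomogenize k)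

/-- The homogeneous ideal of a closed subscheme `X ⊆ ℙⁿ`. A homogeneous `f` of degree `d` lies
in it if and only if, for every `k`, the function `f / xₖ ^ d` on `D₊(xₖ)` vanishes on `X`. -/
def homogeneousIdeal (X : ClosedSubscheme n R) : HomogeneousIdeal (grading n R) :=
  (⨅ k, (X.ideal (chart k)).comap (toChart k)).homogeneousCore (grading n R)

/-- The closed subscheme `V₊(s)` cut out by a set `s` of homogeneous polynomials: the largest
closed subscheme on which all of them vanish, i.e. the one whose ideal sheaf is the smallest that
contains all `f / xₖ ^ deg f`. -/
def zeroScheme (s : Set (MvPolynomial (Fin (n + 1)) R)) : ClosedSubscheme n R :=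
  sInf {X | s ⊆ (homogeneousIdeal X).toIdeal}

/-- The Hilbert function of `X ⊆ ℙⁿ`: the dimension of the degree `d` part of its homogeneous
coordinate ring. -/
def hilbertFunction (X : ClosedSubscheme n R) (d : ℕ) : ℕ :=
  Module.finrank R (grading n R d ⧸
    ((homogeneousIdeal X).toIdeal.restrictScalars R).comap (grading n R d).subtype)

/-- `P` is the Hilbert polynomial of `X ⊆ ℙⁿ`. -/
def HasHilbertPolynomial (X : ClosedSubscheme n R) (P : Polynomial ℚ) : Prop :=
  ∀ᶠ d : ℕ in Filter.atTop, (hilbertFunction X d : ℚ) = P.eval (d : ℚ)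

end Projective

/-! ### Representatives and ultraproducts of closed subschemes -/

section Ultra

variable {S : Type*} (U : Ultrafilter S) {F : S → Type*} [∀ i, CommRing (F i)] {n : ℕ}

/-- The family `Y i ⊆ ℙⁿ` over `F i` is a family of representatives of `X ⊆ ℙⁿ` over the
ultraproduct: `X` is cut out by finitely many homogeneous polynomials, and `Y i` is cut out by
the polynomials obtained by replacing each coefficient by the `i`-th entry of a chosen
representative in `∏ i, F i`. -/
def IsRepresentative (X : ClosedSubscheme n (Ultraproduct U F))
    (Y : ∀ i, ClosedSubscheme n (F i)) : Prop :=
  ∃ (r : ℕ) (d : Fin r → ℕ) (g : Fin r → MvPolynomial (Fin (n + 1)) (∀ i, F i)),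
    (∀ j, (g j).IsHomogeneous (d j)) ∧
    X = zeroScheme (Set.range fun j => map (ultraMk U F) (g j)) ∧
    ∀ i, Y i = zeroScheme (Set.range fun j => map (Pi.evalRingHom F i) (g j))

theorem map_homogeneousComponent {A B : Type*} [CommRing A] [CommRing B] (φ : A →+* B) (d : ℕ)
    (g : MvPolynomial (Fin (n + 1)) A) :
    map φ (homogeneousComponent d g) = homogeneousComponent d (map φ g) := by
  ext m
  simp only [coeff_map, coeff_homogeneousComponent]
  split_ifs <;> simp

theorem component_mem {A : Type*} [CommRing A] (I : HomogeneousIdeal (grading n A)) (d : ℕ)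
    {g : MvPolynomial (Fin (n + 1)) A} (hg : g ∈ I.toIdeal) :
    homogeneousComponent d g ∈ I.toIdeal :=
  homogeneousComponent_mem_of_mem I.isHomogeneous hg d

theorem mem_map_iInf_iff (J : ∀ i, HomogeneousIdeal (grading n (F i)))
    (f : MvPolynomial (Fin (n + 1)) (Ultraproduct U F)) :
    f ∈ Ideal.map (map (ultraMk U F))
        (⨅ i, (J i).toIdeal.comap (map (Pi.evalRingHom F i))) ↔
      ∃ g : MvPolynomial (Fin (n + 1)) (∀ i, F i),
        (∀ i, map (Pi.evalRingHom F i) g ∈ (J i).toIdeal) ∧ map (ultraMk U F) g = f := by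
  rw [Ideal.mem_map_iff_of_surjective _ (map_surjective _ Ideal.Quotient.mk_surjective)]
  simp

/-- The ultraproduct `J` of homogeneous ideals `J i`: the polynomials that are represented by some
`g` over `∏ i, F i` with `i`-th entry in `J i` for every `i`. -/
def ultraproductIdeal (J : ∀ i, HomogeneousIdeal (grading n (F i))) :
    HomogeneousIdeal (grading n (Ultraproduct U F)) :=
  ⟨Ideal.map (map (ultraMk U F)) (⨅ i, (J i).toIdeal.comap (map (Pi.evalRingHom F i))), by
    intro d f hf
    obtain ⟨g, hg, rfl⟩ := (mem_map_iInf_iff U J f).mp hf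
    refine (mem_map_iInf_iff U J _).mpr ⟨homogeneousComponent d g, fun i => ?_, ?_⟩
    · rw [map_homogeneousComponent]
      exact component_mem (J i) d (hg i)
    · rw [map_homogeneousComponent]
      exact (decomposition.decompose'_apply _ d).symm⟩

/-- The degree `d` part of `ultraproductIdeal U J` is the ultraproduct of the degree `d` parts of
the `J i`. -/
theorem mem_ultraproductIdeal_iff (J : ∀ i, HomogeneousIdeal (grading n (F i))) (d : ℕ)
    (f : MvPolynomial (Fin (n + 1)) (Ultraproduct U F)) (hf : f.IsHomogeneous d) :
    f ∈ (ultraproductIdeal U J).toIdeal ↔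
      ∃ h : ∀ i, MvPolynomial (Fin (n + 1)) (F i),
        (∀ i, (h i).IsHomogeneous d ∧ h i ∈ (J i).toIdeal) ∧
        ∀ m, coeff m f = ultraMk U F fun i => coeff m (h i) := by
  refine (mem_map_iInf_iff U J f).trans ⟨?_, ?_⟩
  · rintro ⟨g, hg, rfl⟩
    refine ⟨fun i => homogeneousComponent d (map (Pi.evalRingHom F i) g), fun i =>
      ⟨homogeneousComponent_isHomogeneous _ _, component_mem (J i) d (hg i)⟩, fun m => ?_⟩
    rw [← homogeneousComponent_eq_self hf, ← map_homogeneousComponent, coeff_map]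
    congr 1
    ext i
    change _ = coeff m (homogeneousComponent d (map (Pi.evalRingHom F i) g))
    rw [← map_homogeneousComponent, coeff_map]
    rfl
  · rintro ⟨h, hh, hm⟩
    classical
    let g : MvPolynomial (Fin (n + 1)) (∀ i, F i) :=
      ∑ m ∈ Finset.finsuppAntidiag Finset.univ d, monomial m fun i => coeff m (h i)
    have hmem : ∀ m : Fin (n + 1) →₀ ℕ,
        m ∈ Finset.finsuppAntidiag Finset.univ d ↔ m.degree = d := by
      intro m
      simp [Finset.mem_finsuppAntidiag, Finsupp.degree_eq_sum]
    have hg : ∀ m, coeff m g = fun i => coeff m (h i) := by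
      intro m
      simp only [g, coeff_sum, coeff_monomial, Finset.sum_ite_eq', hmem]
      split_ifs with hd
      · rfl
      · ext i
        exact ((hh i).1.coeff_eq_zero hd).symm
    refine ⟨g, fun i => ?_, ?_⟩
    · have : map (Pi.evalRingHom F i) g = h i := by
        ext m
        rw [coeff_map, hg]
        rfl
      rw [this]
      exact (hh i).2
    · ext m
      rw [coeff_map, hg, hm]

/-- The ultraproduct of closed subschemes `Y i ⊆ ℙⁿ`: the closed subscheme defined by the
ultraproduct of their homogeneous ideals. -/
def ultraproductScheme (Y : ∀ i, ClosedSubscheme n (F i)) :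
    ClosedSubscheme n (Ultraproduct U F) :=
  zeroScheme (ultraproductIdeal U fun i => homogeneousIdeal (Y i)).toIdeal

end Ultra

end UltraHilb

end

/-! Everything is reduced to Hilbert functions of homogeneous ideals. The homogeneous ideal of
`zeroScheme s` is the saturation of the ideal spanned by `s` (`homogeneousIdeal_zeroScheme`), and an
ideal agrees with its saturation in large degrees (`exists_forall_mem_of_mem_sat`).

For (1), take a finite monic Gröbner basis of the ideal spanned by the given polynomials over the
ultraproduct field. The polynomials, and the coefficients writing the basis in terms of them, have
lifts over a finitely generated, hence Noetherian, subring `T` of the product. The kernel of `T` to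
the ultraproduct is finitely generated, so for almost every `i` the map from `T` to `F i` factors
through the image `A` of `T` in the ultraproduct. Over `A` the leading coefficients are still 1, so
division shows that the quotient is free in each degree on the standard monomials. Free bases
survive base change, so the Hilbert functions over `F i` and over the ultraproduct agree in all
degrees simultaneously (`eventually_forall_hilb_span_eq`).

For (2), a fixed degree is easy: there are finitely many sets of monomials of degree `d`, so the
ultrafilter selects one of them as a basis (`eventually_hilb_eq`). The exceptional set of indices
depends on `d`, however, so a degree is needed from which all saturated ideals with Hilbert
polynomial `P`, over all fields, have Hilbert function `P`. This is `exists_uniform_hilb_bound`,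
proved by induction on hyperplane sections together with a bound on the degrees of generators. The
ultraproduct of saturated ideals is saturated, so no further saturation changes the Hilbert
function.

Integrality becomes primality: an integral closed subscheme has a prime homogeneous ideal, an
ultraproduct of primes is prime, and the zero scheme of a saturated homogeneous prime is the closure
of an integral affine scheme in one chart. -/

noncomputable section

namespace UltraHilb

/-! ### Monomial bases of graded pieces and their base change -/

section Standard

variable {σ R : Type*} [CommRing R]

/-- An ideal of a polynomial ring is homogeneous if it contains the homogeneous components of its
elements. -/
def IsGraded (I : Ideal (MvPolynomial σ R)) : Prop :=
  ∀ f ∈ I, ∀ d, homogeneousComponent d f ∈ I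

/-- The Hilbert function of `R[σ] / I`. -/
def hilb (I : Ideal (MvPolynomial σ R)) (d : ℕ) : ℕ :=
  Module.finrank R (homogeneousSubmodule σ R d ⧸
    (I.restrictScalars R).comap (homogeneousSubmodule σ R d).subtype)

/-- `B` is a set of monomials of degree `d` whose classes form a basis of `(R[σ] / I)_d`. -/
structure IsStandard (I : Ideal (MvPolynomial σ R)) (d : ℕ) (B : Set (σ →₀ ℕ)) : Prop where
  degree_eq : ∀ m ∈ B, m.degree = d
  exists_monomial_sub_mem : ∀ m : σ →₀ ℕ, m.degree = d →
    ∃ g ∈ restrictSupport R B, monomial m 1 - g ∈ I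
  eq_zero : ∀ g ∈ restrictSupport R B, g ∈ I → g = 0

theorem homogeneousSubmodule_eq_span (d : ℕ) : homogeneousSubmodule σ R d =
    Submodule.span R ((fun m => monomial m (1 : R)) '' {m : σ →₀ ℕ | m.degree = d}) := by
  rw [homogeneousSubmodule_eq_finsupp_supported, ← restrictSupport_eq_span]
  rfl

theorem restrictSupport_le_homogeneousSubmodule {B : Set (σ →₀ ℕ)} {d : ℕ}
    (hB : ∀ m ∈ B, m.degree = d) : restrictSupport R B ≤ homogeneousSubmodule σ R d := by
  rw [homogeneousSubmodule_eq_span, restrictSupport_eq_span]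
  exact Submodule.span_mono (Set.image_mono hB)

theorem IsStandard.exists_sub_mem {I : Ideal (MvPolynomial σ R)} {d : ℕ} {B : Set (σ →₀ ℕ)}
    (h : IsStandard I d B) {f : MvPolynomial σ R} (hf : f ∈ homogeneousSubmodule σ R d) :
    ∃ g ∈ restrictSupport R B, f - g ∈ I := by
  rw [homogeneousSubmodule_eq_span] at hf
  induction hf using Submodule.span_induction with
  | mem x hx =>
    obtain ⟨m, hm, rfl⟩ := hx
    exact h.exists_monomial_sub_mem m hm
  | zero => exact ⟨0, zero_mem _, by simp⟩
  | add x y _ _ hx hy =>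
    obtain ⟨a, ha, ha'⟩ := hx
    obtain ⟨b, hb, hb'⟩ := hy
    exact ⟨a + b, add_mem ha hb, by simpa [add_sub_add_comm] using add_mem ha' hb'⟩
  | smul c x _ hx =>
    obtain ⟨a, ha, ha'⟩ := hx
    refine ⟨c • a, Submodule.smul_mem _ _ ha, ?_⟩
    rw [← smul_sub, smul_eq_C_mul]
    exact I.mul_mem_left _ ha'

theorem IsStandard.hilb_eq [Nontrivial R] {I : Ideal (MvPolynomial σ R)} {d : ℕ}
    {B : Set (σ →₀ ℕ)} (h : IsStandard I d B) : hilb I d = B.ncard := by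
  let φ := (Submodule.mkQ ((I.restrictScalars R).comap (homogeneousSubmodule σ R d).subtype)) ∘ₗ
    Submodule.inclusion (restrictSupport_le_homogeneousSubmodule (R := R) h.degree_eq)
  have hφ : Function.Bijective φ := by
    constructor
    · rw [← LinearMap.ker_eq_bot, LinearMap.ker_eq_bot']
      rintro ⟨g, hg⟩ hx
      have hx' : g ∈ I := by
        simpa [φ, Submodule.Quotient.mk_eq_zero] using hx
      exact Subtype.ext (h.eq_zero g hg hx')
    · intro x
      obtain ⟨⟨f, hf⟩, rfl⟩ := Submodule.mkQ_surjective _ x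
      obtain ⟨g, hg, hfg⟩ := h.exists_sub_mem hf
      refine ⟨⟨g, hg⟩, ?_⟩
      symm
      refine (Submodule.Quotient.eq _).mpr ?_
      simpa using hfg
  rw [hilb, ← (LinearEquiv.ofBijective φ hφ).finrank_eq,
    Module.finrank_eq_nat_card_basis (basisRestrictSupport R B)]
  rfl

/-- The degree `d` part of the quotient is free on `B`, and freeness is stable under base change.
Spanning is carried over directly; independence is carried over by extending the normal form
operator linearly to the new ring. -/
theorem IsStandard.map {k : Type*} [CommRing k] (ρ : R →+* k) {I : Ideal (MvPolynomial σ R)}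
    (hI : IsGraded I) {d : ℕ} {B : Set (σ →₀ ℕ)} (h : IsStandard I d B) :
    IsStandard (I.map (map ρ)) d B := by
  classical
  have hmap : ∀ g ∈ restrictSupport R B, MvPolynomial.map ρ g ∈ restrictSupport k B := by
    intro g hg
    rw [mem_restrictSupport_iff] at hg ⊢
    exact (Finset.coe_subset.mpr (support_map_subset ρ g)).trans hg
  have key : ∀ m : σ →₀ ℕ, ∃ g ∈ restrictSupport R B,
      homogeneousComponent d (monomial m 1) - g ∈ I := by
    intro m
    exact h.exists_sub_mem (homogeneousComponent_mem _ _)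
  choose NF hNF hNF' using key
  refine ⟨h.degree_eq, fun m hm => ?_, fun g hg hgI => ?_⟩
  · obtain ⟨g, hg, hg'⟩ := h.exists_monomial_sub_mem m hm
    exact ⟨_, hmap g hg, by simpa using Ideal.mem_map_of_mem (MvPolynomial.map ρ) hg'⟩
  -- `T₀` is the projection onto the span of `B` that replaces the degree `d` component by its
  -- normal form, and `T` is its base change. `T₀` kills `I`, so `T` kills the extended ideal; but
  -- `T` fixes the span of `B`, hence the two meet only in 0.
  · let T : MvPolynomial σ k →ₗ[k] MvPolynomial σ k :=
      (basisMonomials σ k).constr k fun m => MvPolynomial.map ρ (NF m)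
    have hT : ∀ m c, T (monomial m c) = C c * MvPolynomial.map ρ (NF m) := by
      intro m c
      have : monomial m c = c • basisMonomials σ k m := by simp [smul_monomial]
      rw [this, map_smul, Module.Basis.constr_basis, smul_eq_C_mul]
    let T₀ : MvPolynomial σ R →ₗ[R] MvPolynomial σ R := (basisMonomials σ R).constr R NF
    have hT₀ : ∀ m c, T₀ (monomial m c) = C c * NF m := by
      intro m c
      have : monomial m c = c • basisMonomials σ R m := by simp [smul_monomial]
      rw [this, map_smul, Module.Basis.constr_basis, smul_eq_C_mul]
    have hcomp : ∀ f, T (MvPolynomial.map ρ f) = MvPolynomial.map ρ (T₀ f) := by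
      intro f
      induction f using MvPolynomial.induction_on' with
      | monomial u a => simp [hT, hT₀]
      | add p q hp hq => simp [hp, hq]
    have hT₀mem : ∀ f, T₀ f ∈ restrictSupport R B ∧ homogeneousComponent d f - T₀ f ∈ I := by
      intro f
      induction f using MvPolynomial.induction_on' with
      | monomial u a =>
        have : monomial u a = a • (monomial u 1 : MvPolynomial σ R) := by simp [smul_monomial]
        rw [hT₀, ← smul_eq_C_mul]
        refine ⟨Submodule.smul_mem _ _ (hNF u), ?_⟩
        rw [this, map_smul, ← smul_sub, smul_eq_C_mul]
        exact I.mul_mem_left _ (hNF' u)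
      | add p q hp hq =>
        rw [map_add, map_add, add_sub_add_comm]
        exact ⟨add_mem hp.1 hq.1, add_mem hp.2 hq.2⟩
    have hT₀I : ∀ f ∈ I, T₀ f = 0 := by
      intro f hf
      refine h.eq_zero _ (hT₀mem f).1 ?_
      simpa using sub_mem (hI f hf d) (hT₀mem f).2
    have hTI : ∀ f ∈ I.map (MvPolynomial.map ρ), ∀ q, T (q * f) = 0 := by
      intro f hf
      induction hf using Submodule.span_induction with
      | mem x hx =>
        obtain ⟨p, hp, rfl⟩ := hx
        intro q
        induction q using MvPolynomial.induction_on' with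
        | monomial u a =>
          have : monomial u a * MvPolynomial.map ρ p =
              a • MvPolynomial.map ρ (monomial u 1 * p) := by
            rw [map_mul, map_monomial, map_one, ← smul_mul_assoc, smul_monomial, smul_eq_mul,
              mul_one]
          rw [this, map_smul, hcomp, hT₀I _ (I.mul_mem_left _ hp), map_zero,
            smul_zero]
        | add a b ha hb => rw [add_mul, map_add, ha, hb, add_zero]
      | zero => simp
      | add x y _ _ hx hy => intro q; rw [mul_add, map_add, hx, hy, add_zero]
      | smul c x _ hx => intro q; rw [smul_eq_mul, ← mul_assoc, hx]
    have hself : ∀ f ∈ restrictSupport k B, T f = f := by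
      intro f hf
      rw [restrictSupport_eq_span] at hf
      induction hf using Submodule.span_induction with
      | mem x hx =>
        obtain ⟨m, hm, rfl⟩ := hx
        have hm' : (monomial m 1 : MvPolynomial σ R) ∈ restrictSupport R B :=
          (monomial_mem_restrictSupport R).mpr (Or.inl hm)
        have h1 : homogeneousComponent d (monomial m (1 : R)) = monomial m 1 :=
          homogeneousComponent_eq_self (isHomogeneous_monomial _ (h.degree_eq m hm))
        have h2 := h.eq_zero _ (sub_mem hm' (hNF m)) (h1 ▸ hNF' m)
        rw [hT, ← sub_eq_zero.mp h2]
        simp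
      | zero => simp
      | add x y _ _ hx hy => rw [map_add, hx, hy]
      | smul c x _ hx => rw [map_smul, hx]
    rw [← hself g hg, ← one_mul g, hTI g hgI]

/-- Division with remainder: the monomials of degree `d` which are not divisible by the leading
monomial of an element of `G` form a standard set, if `G ⊆ I` has invertible leading coefficients
and detects the leading monomials of `I`. -/
theorem isStandard_of_degree_le (o : MonomialOrder σ) {I : Ideal (MvPolynomial σ R)}
    (hI : IsGraded I) {G : Set (MvPolynomial σ R)} (hGI : G ⊆ I)
    (hG : ∀ g ∈ G, IsUnit (o.leadingCoeff g))
    (hlead : ∀ f ∈ I, f ≠ 0 → ∃ g ∈ G, o.degree g ≤ o.degree f) (d : ℕ) :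
    IsStandard I d {m | m.degree = d ∧ ∀ g ∈ G, ¬ o.degree g ≤ m} := by
  classical
  refine ⟨fun m hm => hm.1, fun m hm => ?_, fun g hg hgI => ?_⟩
  · obtain ⟨q, r, h1, -, h3⟩ := o.div_set hG (monomial m 1)
    refine ⟨homogeneousComponent d r, ?_, ?_⟩
    · rw [mem_restrictSupport_iff]
      intro c hc
      rw [Finset.mem_coe, mem_support_iff, coeff_homogeneousComponent] at hc
      split_ifs at hc with hcd
      · exact ⟨hcd, h3 c (mem_support_iff.mpr hc)⟩
      · exact absurd rfl hc
    · have h4 : monomial m (1 : R) - r ∈ I := by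
        rw [h1, add_sub_cancel_right, Finsupp.linearCombination_apply]
        exact I.sum_mem fun b _ => I.mul_mem_left _ (hGI b.2)
      have h5 := hI _ h4 d
      rwa [map_sub, homogeneousComponent_eq_self (isHomogeneous_monomial _ hm)] at h5
  · by_contra hne
    obtain ⟨b, hb, hle⟩ := hlead g hgI hne
    exact (hg (o.degree_mem_support hne)).2 b hb hle

/-- Over a field every nonzero element has an invertible leading coefficient, so all nonzero
elements of `I` can serve as divisors. -/
theorem exists_isStandard [LinearOrder σ] [WellFoundedGT σ] {K : Type*} [Field K]
    {I : Ideal (MvPolynomial σ K)}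
    (hI : IsGraded I) (d : ℕ) : ∃ B, IsStandard I d B := by
  exact ⟨_, isStandard_of_degree_le .lex hI (G := {f | f ∈ I ∧ f ≠ 0}) (fun f hf => hf.1)
    (fun g hg => (MonomialOrder.leadingCoeff_ne_zero_iff.mpr hg.2).isUnit)
    (fun f hf hf0 => ⟨f, ⟨hf, hf0⟩, le_rfl⟩) d⟩

end Standard

/-! ### Ideals generated by homogeneous polynomials -/

section GradedIdeals

variable {σ R : Type*} [CommRing R]

theorem homogeneousComponent_mul_of_isHomogeneous {f : MvPolynomial σ R} {e : ℕ}
    (hf : f.IsHomogeneous e) (q : MvPolynomial σ R) (d : ℕ) :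
    homogeneousComponent d (q * f) = if e ≤ d then homogeneousComponent (d - e) q * f else 0 := by
  classical
  induction q using MvPolynomial.induction_on' with
  | monomial u a =>
    rw [homogeneousComponent_of_mem ((isHomogeneous_monomial a rfl).mul hf),
      homogeneousComponent_of_mem (isHomogeneous_monomial a rfl)]
    split_ifs <;> first | rfl | omega
  | add p q hp hq =>
    rw [add_mul, map_add, hp, hq, map_add]
    split_ifs <;> simp [add_mul]

theorem isGraded_span {s : Set (MvPolynomial σ R)} (hs : ∀ f ∈ s, ∃ d, f.IsHomogeneous d) :
    IsGraded (Ideal.span s) := by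
  -- The extra multiplier `q` absorbs the scalars in the span induction; the same device recurs in
  -- later inductions.
  suffices h : ∀ f ∈ Ideal.span s, ∀ q d, homogeneousComponent d (q * f) ∈ Ideal.span s by
    intro f hf d
    simpa using h f hf 1 d
  intro f hf
  induction hf using Submodule.span_induction with
  | mem x hx =>
    obtain ⟨e, he⟩ := hs x hx
    intro q d
    rw [homogeneousComponent_mul_of_isHomogeneous he]
    split_ifs
    · exact Ideal.mul_mem_left _ _ (Ideal.subset_span hx)
    · exact zero_mem _
  | zero => simp
  | add x y _ _ hx hy => intro q d; rw [mul_add, map_add]; exact add_mem (hx q d) (hy q d)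
  | smul c x _ hx => intro q d; rw [smul_eq_mul, ← mul_assoc]; exact hx _ d

end GradedIdeals

/-! ### Finite Gröbner bases -/

section Groebner

/-- Dickson's lemma through Noetherianity: the ideal generated by the leading monomials is generated
by finitely many of them, and each is the leading monomial of a monic element of `I`. -/
theorem exists_finite_monic {σ K : Type*} [Finite σ] [Field K] (o : MonomialOrder σ)
    (I : Ideal (MvPolynomial σ K)) :
    ∃ G : Finset (MvPolynomial σ K), (∀ g ∈ G, g ∈ I) ∧ (∀ g ∈ G, o.leadingCoeff g = 1) ∧
      ∀ f ∈ I, f ≠ 0 → ∃ g ∈ G, o.degree g ≤ o.degree f := by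
  classical
  let D : Set (σ →₀ ℕ) := {m | ∃ f ∈ I, o.leadingCoeff f = 1 ∧ o.degree f = m}
  have hD : ∀ f ∈ I, f ≠ 0 → o.degree f ∈ D := by
    intro f hf hf0
    have hc := o.leadingCoeff_ne_zero_iff.mpr hf0
    have hu : IsRegular (o.leadingCoeff f)⁻¹ := (inv_ne_zero hc).isUnit.isRegular
    refine ⟨(o.leadingCoeff f)⁻¹ • f, ?_, ?_, o.degree_smul_of_isRegular hu⟩
    · rw [smul_eq_C_mul]
      exact I.mul_mem_left _ hf
    · rw [MonomialOrder.leadingCoeff, o.degree_smul_of_isRegular hu, coeff_smul, smul_eq_mul]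
      exact inv_mul_cancel₀ hc
  obtain ⟨t, ht, hspan⟩ := (Submodule.fg_span_iff_fg_span_finset_subset
    ((fun m => monomial m (1 : K)) '' D)).mp (IsNoetherian.noetherian
      (Submodule.span (MvPolynomial σ K) ((fun m => monomial m (1 : K)) '' D)))
  obtain ⟨t', ht', rfl⟩ := Finset.subset_set_image_iff.mp ht
  choose! φ hφI hφ1 hφd using fun m (hm : m ∈ D) => hm
  refine ⟨t'.image φ, ?_, ?_, ?_⟩
  · intro g hg
    obtain ⟨m, hm, rfl⟩ := Finset.mem_image.mp hg
    exact hφI m (ht' hm)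
  · intro g hg
    obtain ⟨m, hm, rfl⟩ := Finset.mem_image.mp hg
    exact hφ1 m (ht' hm)
  · intro f hf hf0
    have h1 : monomial (o.degree f) (1 : K) ∈
        Ideal.span ((fun m => monomial m (1 : K)) '' (t' : Set (σ →₀ ℕ))) := by
      rw [← Finset.coe_image]
      have : monomial (o.degree f) (1 : K) ∈
          Submodule.span (MvPolynomial σ K) ((fun m => monomial m (1 : K)) '' D) :=
        Submodule.subset_span ⟨_, hD f hf hf0, rfl⟩
      rw [hspan] at this
      exact this
    obtain ⟨m, hm, hle⟩ := mem_ideal_span_monomial_image.mp h1 (o.degree f) (by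
      rw [mem_support_iff, coeff_monomial, if_pos rfl]; exact one_ne_zero)
    exact ⟨φ m, Finset.mem_image_of_mem _ hm, (hφd m (ht' hm)).trans_le hle⟩

end Groebner

/-! ### Spreading out from the ultraproduct to almost every factor -/

section Spread

variable {S : Type*} (U : Ultrafilter S) (F : S → Type*) [∀ i, Field (F i)]

/-- Adjoin the finitely many coefficients to ℤ and apply Hilbert's basis theorem. -/
theorem exists_noetherian_subalgebra {σ A ι : Type*} [CommRing A] [Finite ι]
    (p : ι → MvPolynomial σ A) :
    ∃ (T : Subalgebra ℤ A) (_ : IsNoetherianRing T) (q : ι → MvPolynomial σ T),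
      ∀ j, MvPolynomial.map T.val.toRingHom (q j) = p j := by
  classical
  cases nonempty_fintype ι
  let s : Finset A := Finset.univ.biUnion fun j => (p j).coeffs
  have h : ∀ j, p j ∈ Set.range (MvPolynomial.map (Algebra.adjoin ℤ (s : Set A)).val.toRingHom) := by
    intro j
    rw [mem_range_map_iff_coeffs_subset]
    intro c hc
    exact ⟨⟨c, Algebra.subset_adjoin (Finset.mem_coe.mpr
      (Finset.mem_biUnion.mpr ⟨j, Finset.mem_univ _, hc⟩))⟩, rfl⟩
  choose q hq using h
  exact ⟨Algebra.adjoin ℤ (s : Set A), isNoetherianRing_of_fg (Subalgebra.fg_adjoin_finset s), q, hq⟩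

/-- The kernel of `T` to the ultraproduct has finitely many generators, and each one vanishes at
almost every index. Off a negligible set of indices, `T` modulo this kernel therefore maps to `F i`.
-/
theorem eventually_ker_le {T : Type*} [CommRing T] [IsNoetherianRing T] (ψ : T →+* ∀ i, F i) :
    ∀ᶠ i in (U : Filter S), RingHom.ker ((ultraMk U F).comp ψ) ≤
      RingHom.ker ((Pi.evalRingHom F i).comp ψ) := by
  obtain ⟨s, hs⟩ := IsNoetherian.noetherian (RingHom.ker ((ultraMk U F).comp ψ))
  have h : ∀ a ∈ s, ∀ᶠ i in (U : Filter S), ψ a i = 0 := by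
    intro a ha
    have : a ∈ RingHom.ker ((ultraMk U F).comp ψ) := hs ▸ Submodule.subset_span ha
    exact Ideal.Quotient.eq_zero_iff_mem.mp this
  filter_upwards [(Filter.eventually_all_finset s).mpr h] with i hi
  rw [← hs]
  exact Submodule.span_le.mpr fun a ha => hi a ha

theorem degree_map_of_injective {σ A B : Type*} [CommRing A] [CommRing B] (o : MonomialOrder σ)
    {κ : A →+* B} (hκ : Function.Injective κ) (f : MvPolynomial σ A) :
    o.degree (MvPolynomial.map κ f) = o.degree f := by
  rw [MonomialOrder.degree, MonomialOrder.degree, support_map_of_injective _ hκ]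

theorem leadingCoeff_map_of_injective {σ A B : Type*} [CommRing A] [CommRing B]
    (o : MonomialOrder σ) {κ : A →+* B} (hκ : Function.Injective κ) (f : MvPolynomial σ A) :
    o.leadingCoeff (MvPolynomial.map κ f) = κ (o.leadingCoeff f) := by
  rw [MonomialOrder.leadingCoeff, degree_map_of_injective o hκ, coeff_map,
    MonomialOrder.leadingCoeff]

theorem map_span_range {σ ι A B : Type*} [CommRing A] [CommRing B] (ρ : A →+* B)
    (f : ι → MvPolynomial σ A) : (Ideal.span (Set.range f)).map (MvPolynomial.map ρ) =
      Ideal.span (Set.range fun j => MvPolynomial.map ρ (f j)) := by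
  rw [Ideal.map_span, ← Set.range_comp]
  rfl

/-- The Hilbert functions of the ideals generated by the entries of finitely many homogeneous
polynomials over a product of fields are almost everywhere equal to the one over the ultraproduct,
in all degrees at once. -/
theorem eventually_forall_hilb_span_eq {σ ι : Type*} [LinearOrder σ] [Finite σ] [Finite ι]
    (p : ι → MvPolynomial σ (∀ i, F i)) (hp : ∀ j, ∃ e, (p j).IsHomogeneous e) :
    ∀ᶠ i in (U : Filter S), ∀ d,
      hilb (Ideal.span (Set.range fun j => MvPolynomial.map (Pi.evalRingHom F i) (p j))) d =
        hilb (Ideal.span (Set.range fun j => MvPolynomial.map (ultraMk U F) (p j))) d := by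
  classical
  cases nonempty_fintype ι
  let _ : Field (Ultraproduct U F) := Ideal.Quotient.field _
  let o : MonomialOrder σ := .lex
  obtain ⟨G, hGI, hG1, hG⟩ := exists_finite_monic o
    (Ideal.span (Set.range fun j => MvPolynomial.map (ultraMk U F) (p j)))
  -- These coefficients must be carried along: they place the Gröbner basis in the ideal already
  -- over the small ring, not only over the ultraproduct.
  have hc : ∀ g : G, ∃ c : ι → MvPolynomial σ (∀ i, F i),
      ∑ j, MvPolynomial.map (ultraMk U F) (c j) * MvPolynomial.map (ultraMk U F) (p j) = g := by
    intro g
    obtain ⟨c, hc⟩ := Submodule.mem_span_range_iff_exists_fun _ |>.mp (hGI g g.2)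
    choose c' hc' using fun j => map_surjective (ultraMk U F) Ideal.Quotient.mk_surjective (c j)
    exact ⟨c', by simpa [hc'] using hc⟩
  choose c hc using hc
  obtain ⟨T, hT, q, hq⟩ := exists_noetherian_subalgebra
    (Sum.elim p fun x : G × ι => c x.1 x.2)
  let ψ : T →+* ∀ i, F i := T.val.toRingHom
  let θ : T →+* Ultraproduct U F := (ultraMk U F).comp ψ
  let π : T →+* T ⧸ RingHom.ker θ := Ideal.Quotient.mk _
  let κ : T ⧸ RingHom.ker θ →+* Ultraproduct U F := RingHom.kerLift θ
  have hκ : Function.Injective κ := RingHom.kerLift_injective θ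
  have hκπ : ∀ x : MvPolynomial σ T, MvPolynomial.map κ (MvPolynomial.map π x) =
      MvPolynomial.map (ultraMk U F) (MvPolynomial.map ψ x) := by
    intro x
    rw [map_map, map_map]
    rfl
  let f : ι → MvPolynomial σ (T ⧸ RingHom.ker θ) := fun j => MvPolynomial.map π (q (.inl j))
  have hf : ∀ j, MvPolynomial.map κ (f j) = MvPolynomial.map (ultraMk U F) (p j) := by
    intro j
    rw [hκπ, hq]
    rfl
  let I := Ideal.span (Set.range f)
  have hI : IsGraded I := by
    refine isGraded_span ?_
    rintro _ ⟨j, rfl⟩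
    obtain ⟨e, he⟩ := hp j
    refine ⟨e, fun m hm => he (d := m) fun h0 => hm ?_⟩
    apply hκ
    rw [← coeff_map, hf, coeff_map, h0, map_zero, map_zero]
  have hIκ : I.map (MvPolynomial.map κ) =
      Ideal.span (Set.range fun j => MvPolynomial.map (ultraMk U F) (p j)) := by
    rw [map_span_range, funext hf]
  let γ : G → MvPolynomial σ (T ⧸ RingHom.ker θ) := fun g =>
    ∑ j, MvPolynomial.map π (q (.inr (g, j))) * f j
  have hγ : ∀ g, MvPolynomial.map κ (γ g) = g := by
    intro g
    rw [← hc g, map_sum]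
    refine Finset.sum_congr rfl fun j _ => ?_
    rw [map_mul, hf, hκπ, hq]
    rfl
  -- Since `κ` is injective it preserves leading monomials, so the Gröbner property and the leading
  -- coefficients 1 descend to `T ⧸ ker θ`.
  have hstd : ∀ d, IsStandard I d _ := fun d => by
    refine isStandard_of_degree_le o hI (G := Set.range γ) ?_ ?_ ?_ d
    · rintro _ ⟨g, rfl⟩
      exact I.sum_mem fun j _ => I.mul_mem_left _ (Ideal.subset_span ⟨j, rfl⟩)
    · rintro _ ⟨g, rfl⟩
      have h1 : κ (o.leadingCoeff (γ g)) = κ 1 := by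
        rw [← leadingCoeff_map_of_injective o hκ, hγ, hG1 g g.2, map_one]
      rw [hκ h1]
      exact isUnit_one
    · intro x hx hx0
      obtain ⟨g, hg, hle⟩ := hG (MvPolynomial.map κ x) (hIκ ▸ Ideal.mem_map_of_mem _ hx)
        ((map_ne_zero_iff _ (map_injective κ hκ)).mpr hx0)
      refine ⟨_, ⟨⟨g, hg⟩, rfl⟩, ?_⟩
      rwa [← degree_map_of_injective o hκ (γ _), hγ, ← degree_map_of_injective o hκ x]
  filter_upwards [eventually_ker_le U F ψ] with i hi d
  let ρ : T ⧸ RingHom.ker θ →+* F i :=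
    Ideal.Quotient.lift _ ((Pi.evalRingHom F i).comp ψ) fun a ha => hi ha
  have hfi : ∀ j, MvPolynomial.map ρ (f j) = MvPolynomial.map (Pi.evalRingHom F i) (p j) := by
    intro j
    have h1 : p j = MvPolynomial.map ψ (q (.inl j)) := (hq (.inl j)).symm
    rw [h1, map_map, map_map]
    rfl
  -- Both ideals are base changes of `I`, along `ρ` and along `κ`, so both Hilbert functions count
  -- the same standard monomials.
  rw [← funext hfi, ← map_span_range, ← hIκ, ((hstd d).map ρ hI).hilb_eq, ((hstd d).map κ hI).hilb_eq]

end Spread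

/-! ### Saturation with respect to the variables -/

section Saturation

variable {σ R : Type*} [CommRing R]

/-- An ideal is saturated (with respect to the ideal of the variables). -/
def IsSaturated (I : Ideal (MvPolynomial σ R)) : Prop :=
  ∀ f, (∀ k, X k * f ∈ I) → f ∈ I

/-- The saturation of an ideal with respect to the ideal of the variables. -/
def sat (I : Ideal (MvPolynomial σ R)) : Ideal (MvPolynomial σ R) where
  carrier := {f | ∀ k, ∃ N, X k ^ N * f ∈ I}
  zero_mem' k := ⟨0, by simp⟩
  add_mem' {f g} hf hg k := by
    obtain ⟨N, hN⟩ := hf k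
    obtain ⟨M, hM⟩ := hg k
    refine ⟨N + M, ?_⟩
    have : X k ^ (N + M) * (f + g) = X k ^ M * (X k ^ N * f) + X k ^ N * (X k ^ M * g) := by ring
    rw [this]
    exact add_mem (I.mul_mem_left _ hN) (I.mul_mem_left _ hM)
  smul_mem' c f hf k := by
    obtain ⟨N, hN⟩ := hf k
    refine ⟨N, ?_⟩
    rw [smul_eq_mul, mul_left_comm]
    exact I.mul_mem_left _ hN

theorem mem_sat {I : Ideal (MvPolynomial σ R)} {f : MvPolynomial σ R} :
    f ∈ sat I ↔ ∀ k, ∃ N, X k ^ N * f ∈ I := Iff.rfl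

theorem le_sat (I : Ideal (MvPolynomial σ R)) : I ≤ sat I :=
  fun f hf _ => ⟨0, by simpa using hf⟩

theorem isSaturated_sat (I : Ideal (MvPolynomial σ R)) : IsSaturated (sat I) := by
  intro f hf k
  obtain ⟨N, hN⟩ := hf k k
  exact ⟨N + 1, by rwa [pow_succ, mul_assoc]⟩

theorem IsGraded.sat {I : Ideal (MvPolynomial σ R)} (hI : IsGraded I) : IsGraded (sat I) := by
  intro f hf d k
  obtain ⟨N, hN⟩ := hf k
  refine ⟨N, ?_⟩
  have h := hI _ hN (d + N)
  rw [mul_comm, homogeneousComponent_mul_of_isHomogeneous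
    (by simpa using (isHomogeneous_X R k).pow N)] at h
  simpa [mul_comm] using h

/-- High degree polynomials multiply a given element of the saturation into the ideal. -/
theorem exists_mul_mem_of_mem_sat [Fintype σ] {I : Ideal (MvPolynomial σ R)}
    {f : MvPolynomial σ R} (hf : f ∈ sat I) :
    ∃ M, ∀ d ≥ M, ∀ q : MvPolynomial σ R, q.IsHomogeneous d → q * f ∈ I := by
  choose N hN using hf
  -- Pigeonhole: a monomial of degree greater than the sum of the `N k` is divisible by some `X k ^
  -- N k`.
  refine ⟨∑ k, N k + 1, fun d hd q hq => ?_⟩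
  rw [← mem_homogeneousSubmodule, homogeneousSubmodule_eq_span] at hq
  induction hq using Submodule.span_induction with
  | mem x hx =>
    obtain ⟨m, hm, rfl⟩ := hx
    obtain ⟨k, hk⟩ : ∃ k, N k ≤ m k := by
      by_contra! hlt
      have h1 : m.degree ≤ ∑ k, N k := by
        rw [Finsupp.degree_eq_sum]
        exact Finset.sum_le_sum fun k _ => (hlt k).le
      have h2 : m.degree = d := hm
      omega
    have h3 : m = (m - Finsupp.single k (N k)) + Finsupp.single k (N k) :=
      (tsub_add_cancel_of_le (Finsupp.single_le_iff.mpr hk)).symm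
    dsimp only
    rw [h3, monomial_add_single, mul_assoc]
    exact I.mul_mem_left _ (hN k)
  | zero => simp
  | add x y _ _ hx hy => rw [add_mul]; exact add_mem hx hy
  | smul c x _ hx => rw [smul_mul_assoc, smul_eq_C_mul]; exact I.mul_mem_left _ hx

theorem IsSaturated.mem_of_forall_mul_mem {I : Ideal (MvPolynomial σ R)} (hI : IsSaturated I)
    {f : MvPolynomial σ R} {d : ℕ}
    (h : ∀ q : MvPolynomial σ R, q.IsHomogeneous d → q * f ∈ I) : f ∈ I := by
  induction d with
  | zero => simpa using h 1 (isHomogeneous_one σ R)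
  | succ d ih =>
    refine ih fun q hq => hI _ fun k => ?_
    rw [← mul_assoc]
    exact h _ (by simpa [add_comm] using (isHomogeneous_X R k).mul hq)

theorem IsSaturated.sat_eq [Fintype σ] {I : Ideal (MvPolynomial σ R)} (hI : IsSaturated I) :
    sat I = I := by
  refine le_antisymm (fun f hf => ?_) (le_sat I)
  obtain ⟨M, hM⟩ := exists_mul_mem_of_mem_sat hf
  exact hI.mem_of_forall_mul_mem (hM M le_rfl)

/-- The saturation is finitely generated, and each homogeneous component of a generator is
multiplied into `I` by all forms of large degree. `D` takes the maximum of the resulting thresholds,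
shifted by the degree of the component. -/
theorem exists_forall_mem_of_mem_sat [Fintype σ] [IsNoetherianRing R]
    {I : Ideal (MvPolynomial σ R)} (hI : IsGraded I) :
    ∃ D, ∀ d ≥ D, ∀ f : MvPolynomial σ R, f.IsHomogeneous d → f ∈ sat I → f ∈ I := by
  classical
  obtain ⟨t, ht⟩ := IsNoetherian.noetherian (sat I)
  have h1 : ∀ g : MvPolynomial σ R, ∀ e, ∃ M, g ∈ t → ∀ d ≥ M, ∀ q : MvPolynomial σ R,
      q.IsHomogeneous d → q * homogeneousComponent e g ∈ I := by
    intro g e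
    by_cases hg : g ∈ t
    · have hg' : g ∈ sat I := ht ▸ Submodule.subset_span hg
      obtain ⟨M, hM⟩ := exists_mul_mem_of_mem_sat (hI.sat g hg' e)
      exact ⟨M, fun _ => hM⟩
    · exact ⟨0, fun h => absurd h hg⟩
  choose M hM using h1
  let D := t.sup fun g => (Finset.range (g.totalDegree + 1)).sup fun e => M g e + e
  have hD : ∀ f ∈ sat I, ∀ q, ∀ d ≥ D, homogeneousComponent d (q * f) ∈ I := by
    intro f hf
    rw [← ht] at hf
    induction hf using Submodule.span_induction with
    | mem g hg =>
      intro q d hd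
      rw [← sum_homogeneousComponent g, Finset.mul_sum, map_sum]
      refine I.sum_mem fun e he => ?_
      rw [homogeneousComponent_mul_of_isHomogeneous (homogeneousComponent_isHomogeneous _ _)]
      split_ifs with hed
      · refine hM g e hg _ ?_ _ (homogeneousComponent_isHomogeneous _ _)
        have h2 : M g e + e ≤ D :=
          (Finset.le_sup (f := fun e => M g e + e) he).trans
            (Finset.le_sup (f := fun g => (Finset.range (g.totalDegree + 1)).sup
              fun e => M g e + e) hg)
        omega
      · exact zero_mem _
    | zero => simp
    | add x y _ _ hx hy =>
      intro q d hd; rw [mul_add, map_add]; exact add_mem (hx q d hd) (hy q d hd)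
    | smul c x _ hx => intro q d hd; rw [smul_eq_mul, ← mul_assoc]; exact hx _ d hd
  refine ⟨D, fun d hd f hfd hf => ?_⟩
  have := hD f hf 1 d hd
  rwa [one_mul, homogeneousComponent_eq_self hfd] at this

end Saturation

/-! ### Hilbert functions over a field and hyperplane sections -/

section Dimension

variable {σ K : Type*} [Field K]

/-- The degree `d` part of an ideal. -/
def degreePart (I : Ideal (MvPolynomial σ K)) (d : ℕ) : Submodule K (MvPolynomial σ K) :=
  I.restrictScalars K ⊓ homogeneousSubmodule σ K d

theorem hilb_congr {I J : Ideal (MvPolynomial σ K)} {d : ℕ}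
    (h : ∀ f : MvPolynomial σ K, f.IsHomogeneous d → (f ∈ I ↔ f ∈ J)) : hilb I d = hilb J d := by
  have : (I.restrictScalars K).comap (homogeneousSubmodule σ K d).subtype =
      (J.restrictScalars K).comap (homogeneousSubmodule σ K d).subtype := by
    ext ⟨f, hf⟩
    exact h f hf
  rw [hilb, hilb, this]

theorem degreePart_mono {I J : Ideal (MvPolynomial σ K)} (h : I ≤ J) (d : ℕ) :
    degreePart I d ≤ degreePart J d := inf_le_inf_right _ h

theorem exists_of_mem_sup_span {I : Ideal (MvPolynomial σ K)} (hI : IsGraded I)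
    {l : MvPolynomial σ K} (hl : l.IsHomogeneous 1) {d : ℕ} {f : MvPolynomial σ K}
    (hf : f.IsHomogeneous (d + 1)) (hfI : f ∈ I ⊔ Ideal.span {l}) :
    ∃ a b : MvPolynomial σ K, a ∈ I ∧ a.IsHomogeneous (d + 1) ∧ b.IsHomogeneous d ∧
      f = a + b * l := by
  obtain ⟨a, ha, c, hc, rfl⟩ := Submodule.mem_sup.mp hfI
  obtain ⟨b, rfl⟩ := Ideal.mem_span_singleton'.mp hc
  refine ⟨homogeneousComponent (d + 1) a, homogeneousComponent d b, hI _ ha _,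
    homogeneousComponent_isHomogeneous _ _, homogeneousComponent_isHomogeneous _ _, ?_⟩
  conv_lhs => rw [← homogeneousComponent_eq_self hf]
  rw [map_add, homogeneousComponent_mul_of_isHomogeneous hl]
  simp

theorem isGraded_sup_span {I : Ideal (MvPolynomial σ K)} (hI : IsGraded I)
    {l : MvPolynomial σ K} (hl : l.IsHomogeneous 1) : IsGraded (I ⊔ Ideal.span {l}) := by
  intro f hf d
  obtain ⟨a, ha, c, hc, rfl⟩ := Submodule.mem_sup.mp hf
  rw [map_add]
  refine add_mem (Ideal.mem_sup_left (hI _ ha _)) (Ideal.mem_sup_right ?_)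
  exact isGraded_span (by rintro _ rfl; exact ⟨1, hl⟩) _ hc _

theorem finrank_map_of_injective {V W : Type*} [AddCommGroup V] [Module K V] [AddCommGroup W]
    [Module K W] {f : V →ₗ[K] W} (hf : Function.Injective f) (p : Submodule K V) :
    Module.finrank K (p.map f) = Module.finrank K p :=
  (Submodule.equivMapOfInjective f hf p).finrank_eq.symm

variable [Finite σ]

instance (d : ℕ) : FiniteDimensional K (homogeneousSubmodule σ K d) := by
  rw [homogeneousSubmodule_eq_span]
  refine FiniteDimensional.span_of_finite K (Set.Finite.image _ ?_)
  exact (Finsupp.finite_of_degree_le d).subset fun m hm => (Set.mem_ofPred.mp hm).le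

instance (I : Ideal (MvPolynomial σ K)) (d : ℕ) : FiniteDimensional K (degreePart I d) :=
  Submodule.finiteDimensional_of_le inf_le_right

theorem hilb_add_finrank (I : Ideal (MvPolynomial σ K)) (d : ℕ) :
    hilb I d + Module.finrank K (degreePart I d) =
      Module.finrank K (homogeneousSubmodule σ K d) := by
  have h1 : degreePart I d = ((I.restrictScalars K).comap
      (homogeneousSubmodule σ K d).subtype).map (homogeneousSubmodule σ K d).subtype := by
    rw [Submodule.map_comap_subtype, inf_comm]
    rfl
  rw [h1, finrank_map_of_injective (Subtype.val_injective)]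
  exact Submodule.finrank_quotient_add_finrank _

theorem hilb_anti {I J : Ideal (MvPolynomial σ K)} (h : I ≤ J) (d : ℕ) : hilb J d ≤ hilb I d := by
  have h1 := hilb_add_finrank I d
  have h2 := hilb_add_finrank J d
  have h3 := Submodule.finrank_mono (degreePart_mono h d)
  omega

theorem mem_of_hilb_eq {I J : Ideal (MvPolynomial σ K)} (h : I ≤ J) {d : ℕ}
    (hd : hilb I d = hilb J d) {f : MvPolynomial σ K} (hf : f.IsHomogeneous d) (hfJ : f ∈ J) :
    f ∈ I := by
  have h1 := hilb_add_finrank I d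
  have h2 := hilb_add_finrank J d
  have h3 := Submodule.eq_of_le_of_finrank_eq (degreePart_mono h d) (by omega)
  have h4 : f ∈ degreePart J d := ⟨hfJ, hf⟩
  rw [← h3] at h4
  exact h4.1

/-- The Hilbert function of a hyperplane section by a nonzerodivisor. -/
theorem hilb_sup_span {I : Ideal (MvPolynomial σ K)} (hI : IsGraded I)
    {l : MvPolynomial σ K} (hl : l.IsHomogeneous 1) (hl0 : l ≠ 0)
    (hreg : ∀ f, f * l ∈ I → f ∈ I) (d : ℕ) :
    hilb (I ⊔ Ideal.span {l}) (d + 1) + hilb I d = hilb I (d + 1) := by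
  let μ : MvPolynomial σ K →ₗ[K] MvPolynomial σ K := LinearMap.mulRight K l
  have hμ : Function.Injective μ := fun a b hab => mul_right_cancel₀ hl0 hab
  have h1 : degreePart (I ⊔ Ideal.span {l}) (d + 1) =
      degreePart I (d + 1) ⊔ (homogeneousSubmodule σ K d).map μ := by
    apply le_antisymm
    · rintro f ⟨hf, hfd⟩
      obtain ⟨a, b, ha, had, hb, rfl⟩ := exists_of_mem_sup_span hI hl hfd hf
      exact Submodule.add_mem_sup ⟨ha, had⟩ ⟨b, hb, rfl⟩
    · refine sup_le (degreePart_mono le_sup_left _) ?_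
      rintro _ ⟨b, hb, rfl⟩
      exact ⟨Ideal.mem_sup_right (Ideal.mul_mem_left _ _ (Ideal.mem_span_singleton_self l)),
        IsHomogeneous.mul hb hl⟩
  -- Regularity of `l` enters here: a multiple of `l` lying in `I` is `l` times an element of `I`.
  -- The count then follows from the dimension formula for a sum and an intersection.
  have h2 : degreePart I (d + 1) ⊓ (homogeneousSubmodule σ K d).map μ =
      (degreePart I d).map μ := by
    apply le_antisymm
    · rintro _ ⟨⟨hf, _⟩, ⟨b, hb, rfl⟩⟩
      exact ⟨b, ⟨hreg b hf, hb⟩, rfl⟩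
    · rintro _ ⟨b, ⟨hb, hbd⟩, rfl⟩
      exact ⟨⟨I.mul_mem_right _ hb, IsHomogeneous.mul hbd hl⟩, ⟨b, hbd, rfl⟩⟩
  have h3 := Submodule.finrank_sup_add_finrank_inf_eq (degreePart I (d + 1))
    ((homogeneousSubmodule σ K d).map μ)
  rw [← h1, h2, finrank_map_of_injective hμ, finrank_map_of_injective hμ] at h3
  have h4 := hilb_add_finrank (I ⊔ Ideal.span {l}) (d + 1)
  have h5 := hilb_add_finrank I d
  have h6 := hilb_add_finrank I (d + 1)
  omega

/-- The zero divisors modulo `I` form the union of the finitely many associated primes. None of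
these contains all variables: such a prime would be the annihilator of a class `f` with `X k * f ∈
I` for all `k`, forcing `f ∈ I` by saturation. Over an infinite field the space of linear forms is
not a finite union of proper subspaces. -/
theorem exists_linear_regular [Infinite K] {I : Ideal (MvPolynomial σ K)} (hI : IsSaturated I)
    (hI1 : I ≠ ⊤) :
    ∃ l : MvPolynomial σ K, l.IsHomogeneous 1 ∧ l ≠ 0 ∧ ∀ f, f * l ∈ I → f ∈ I := by
  classical
  have hfin := associatedPrimes.finite (MvPolynomial σ K) (MvPolynomial σ K ⧸ I)
  let V : Ideal (MvPolynomial σ K) → Submodule K (homogeneousSubmodule σ K 1) := fun p =>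
    (p.restrictScalars K).comap (homogeneousSubmodule σ K 1).subtype
  have htop : ⊤ ∉ hfin.toFinset.image V := by
    intro h
    obtain ⟨p, hp, hV⟩ := Finset.mem_image.mp h
    rw [Set.Finite.mem_toFinset, AssociatedPrimes.mem_iff, isAssociatedPrime_iff] at hp
    obtain ⟨hprime, x, rfl⟩ := hp
    obtain ⟨f, rfl⟩ := Ideal.Quotient.mk_surjective x
    apply hprime.ne_top
    have hmem : ∀ q, q ∈ Submodule.colon ⊥ {Ideal.Quotient.mk I f} ↔ q * f ∈ I := by
      intro q
      rw [Submodule.mem_colon_singleton, Submodule.mem_bot, ← Ideal.Quotient.eq_zero_iff_mem,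
        map_mul]
      rfl
    rw [Ideal.eq_top_iff_one, hmem, one_mul]
    refine hI f fun k => (hmem _).mp ?_
    have h1 : (⟨X k, isHomogeneous_X K k⟩ : homogeneousSubmodule σ K 1) ∈ V _ :=
      hV ▸ Submodule.mem_top
    exact h1
  obtain ⟨⟨l, hl⟩, hlV⟩ := (Set.ne_univ_iff_exists_notMem _).mp
    (Subspace.biUnion_ne_univ_of_top_notMem htop)
  have hreg : ∀ f, f * l ∈ I → f ∈ I := by
    intro f hf
    by_contra hfI
    have h1 : l ∈ ⋃ p ∈ associatedPrimes (MvPolynomial σ K) (MvPolynomial σ K ⧸ I),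
        (p : Set (MvPolynomial σ K)) := by
      rw [biUnion_associatedPrimes_eq_zero_divisors]
      refine ⟨Ideal.Quotient.mk I f, fun h => hfI (Ideal.Quotient.eq_zero_iff_mem.mp h), ?_⟩
      rw [← Ideal.Quotient.eq_zero_iff_mem, mul_comm, map_mul] at hf
      exact hf
    obtain ⟨p, hp, hlp⟩ := Set.mem_iUnion₂.mp h1
    exact hlV (Set.mem_iUnion₂.mpr
      ⟨V p, Finset.mem_image_of_mem _ (hfin.mem_toFinset.mpr hp), hlp⟩)
  refine ⟨l, hl, ?_, hreg⟩
  rintro rfl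
  exact hI1 (I.eq_top_iff_one.mpr (hreg 1 (by simp)))

end Dimension

/-! ### A regularity bound depending only on the Hilbert polynomial -/

section UniformBound

universe u v

/-- From `e` on the sequence falls by at least 1 until it first repeats a value; from then on it is
constant, hence equal to its eventual value 0. Being nonnegative and at most `N` at `e`, it cannot
fall more than `N` times. -/
theorem eq_zero_of_decreasing {δ : ℕ → ℚ} {e N : ℕ}
    (hstep : ∀ d ≥ e, δ (d + 1) = δ d ∨ δ (d + 1) ≤ δ d - 1)
    (hstat : ∀ d ≥ e, δ (d + 1) = δ d → δ (d + 2) = δ (d + 1))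
    (hev : ∀ᶠ d in Filter.atTop, δ d = 0) (hN : δ e ≤ N) : ∀ d ≥ e + N, δ d = 0 := by
  obtain ⟨D, hD⟩ := Filter.eventually_atTop.mp hev
  have hanti : ∀ d ≥ e, ∀ j, δ (d + j) ≤ δ d := by
    intro d hd j
    induction j with
    | zero => exact le_rfl
    | succ j ih =>
      rcases hstep (d + j) (by omega) with h | h
      · rw [← add_assoc, h]; exact ih
      · rw [← add_assoc]; linarith
  have hnonneg : ∀ d ≥ e, 0 ≤ δ d := by
    intro d hd
    have := hanti d hd D
    rwa [hD (d + D) (by omega)] at this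
  have hconst : ∀ d ≥ e, δ (d + 1) = δ d → δ d = 0 := by
    intro d hd h
    have h1 : ∀ j, δ (d + j + 1) = δ (d + j) ∧ δ (d + j) = δ d := by
      intro j
      induction j with
      | zero => exact ⟨h, rfl⟩
      | succ j ih => exact ⟨hstat (d + j) (by omega) ih.1, ih.1.trans ih.2⟩
    rw [← (h1 D).2, hD (d + D) (by omega)]
  have hmain : ∀ j : ℕ, δ (e + j) = 0 ∨ δ (e + j) ≤ N - j := by
    intro j
    induction j with
    | zero => right; simpa using hN
    | succ j ih =>
      have h0 := hnonneg (e + (j + 1)) (by omega)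
      rcases hstep (e + j) (by omega) with h | h
      · left
        rw [← add_assoc, h]
        exact hconst _ (by omega) h
      · rcases ih with ih | ih
        · rw [← add_assoc] at h0
          linarith
        · right
          push_cast
          rw [← add_assoc]
          linarith
  have heN : δ (e + N) = 0 := by
    rcases hmain N with h | h
    · exact h
    · exact le_antisymm (by simpa using h) (hnonneg _ (by omega))
  intro d hd
  have h1 := hanti (e + N) (by omega) (d - (e + N))
  rw [Nat.add_sub_cancel' hd, heN] at h1
  exact le_antisymm h1 (hnonneg d (by omega))

theorem exists_eq_sum_mul_X {σ R : Type*} [Fintype σ] [CommRing R] {d : ℕ}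
    {f : MvPolynomial σ R} (hf : f.IsHomogeneous (d + 1)) :
    ∃ g : σ → MvPolynomial σ R, (∀ k, (g k).IsHomogeneous d) ∧ f = ∑ k, g k * X k := by
  classical
  rw [← mem_homogeneousSubmodule, homogeneousSubmodule_eq_span] at hf
  induction hf using Submodule.span_induction with
  | mem x hx =>
    obtain ⟨m, hm, rfl⟩ := hx
    have hm' : m.degree = d + 1 := hm
    obtain ⟨k, hk⟩ : ∃ k, m k ≠ 0 := by
      by_contra! h
      have : m = 0 := Finsupp.ext h
      simp [this] at hm'
    have h3 : m = (m - Finsupp.single k 1) + Finsupp.single k 1 :=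
      (tsub_add_cancel_of_le (Finsupp.single_le_iff.mpr (Nat.one_le_iff_ne_zero.mpr hk))).symm
    have h4 : (m - Finsupp.single k 1).degree = d := by
      have := congrArg Finsupp.degree h3
      rw [map_add, Finsupp.degree_single, hm'] at this
      omega
    refine ⟨Pi.single k (monomial (m - Finsupp.single k 1) 1), fun j => ?_, ?_⟩
    · by_cases hjk : j = k
      · subst hjk
        rw [Pi.single_eq_same]
        exact isHomogeneous_monomial _ h4
      · rw [Pi.single_eq_of_ne hjk]
        exact isHomogeneous_zero _ _ _
    · rw [Finset.sum_eq_single k]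
      · rw [Pi.single_eq_same]
        dsimp only
        conv_lhs => rw [h3, monomial_add_single, pow_one]
      · intro j _ hj
        rw [Pi.single_eq_of_ne hj, zero_mul]
      · simp
  | zero => exact ⟨0, fun _ => isHomogeneous_zero _ _ _, by simp⟩
  | add x y _ _ hx hy =>
    obtain ⟨a, ha, rfl⟩ := hx
    obtain ⟨b, hb, rfl⟩ := hy
    exact ⟨a + b, fun k => (ha k).add (hb k), by simp [add_mul, Finset.sum_add_distrib]⟩
  | smul c x _ hx =>
    obtain ⟨a, ha, rfl⟩ := hx
    exact ⟨c • a, fun k => (homogeneousSubmodule σ R d).smul_mem c (ha k),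
      by simp [Finset.smul_sum]⟩

theorem hilb_top {σ K : Type*} [Field K] (d : ℕ) :
    hilb (⊤ : Ideal (MvPolynomial σ K)) d = 0 := by
  have : ((⊤ : Ideal (MvPolynomial σ K)).restrictScalars K).comap
      (homogeneousSubmodule σ K d).subtype = ⊤ := rfl
  rw [hilb, this]
  exact Module.finrank_zero_of_subsingleton

theorem hilb_zero_pos {σ K : Type*} [Finite σ] [Field K] {I : Ideal (MvPolynomial σ K)}
    (hI : I ≠ ⊤) : 1 ≤ hilb I 0 := by
  by_contra! h
  have h0 : hilb I 0 = hilb (⊤ : Ideal (MvPolynomial σ K)) 0 := by rw [hilb_top]; omega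
  exact hI (I.eq_top_iff_one.mpr
    (mem_of_hilb_eq le_top h0 (isHomogeneous_one σ K) Submodule.mem_top))

theorem eq_zero_of_eventually_eval_eq_zero {P : Polynomial ℚ}
    (h : ∀ᶠ d : ℕ in Filter.atTop, P.eval (d : ℚ) = 0) : P = 0 := by
  obtain ⟨D, hD⟩ := Filter.eventually_atTop.mp h
  apply Polynomial.eq_zero_of_infinite_isRoot
  refine Set.Infinite.mono ?_ ((Set.Ici_infinite D).image (Nat.cast_injective (R := ℚ)).injOn)
  rintro _ ⟨d, hd, rfl⟩
  exact hD d hd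

/-- Saturated homogeneous ideals with a given Hilbert polynomial have Hilbert function equal to
the Hilbert polynomial, and are generated in lower degree, from some degree on which does not depend
on the ideal or the field. -/
theorem exists_uniform_bound (σ : Type v) [Fintype σ] (m : ℕ) : ∀ P : Polynomial ℚ, ∃ e : ℕ,
    ∀ (K : Type u) [Field K] [Infinite K] (I : Ideal (MvPolynomial σ K)),
      IsGraded I → IsSaturated I → hilb I 1 ≤ m →
      (∀ᶠ d : ℕ in Filter.atTop, (hilb I d : ℚ) = P.eval (d : ℚ)) →
      (∀ d ≥ e, (hilb I d : ℚ) = P.eval (d : ℚ)) ∧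
      ∀ d ≥ e, ∀ f ∈ I, f.IsHomogeneous (d + 1) → ∃ g : σ → MvPolynomial σ K,
        (∀ k, g k ∈ I ∧ (g k).IsHomogeneous d) ∧ f = ∑ k, g k * X k := by
  -- The unit ideal is treated separately, because `exists_linear_regular` and `hilb_zero_pos`
  -- require a proper ideal.
  have htop : ∀ (P : Polynomial ℚ) (e : ℕ) (K : Type u) [Field K] [Infinite K]
      (I : Ideal (MvPolynomial σ K)), I = ⊤ →
      (∀ᶠ d : ℕ in Filter.atTop, (hilb I d : ℚ) = P.eval (d : ℚ)) →
      (∀ d ≥ e, (hilb I d : ℚ) = P.eval (d : ℚ)) ∧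
      ∀ d ≥ e, ∀ f ∈ I, f.IsHomogeneous (d + 1) → ∃ g : σ → MvPolynomial σ K,
        (∀ k, g k ∈ I ∧ (g k).IsHomogeneous d) ∧ f = ∑ k, g k * X k := by
    rintro P e K _ _ I rfl hP
    have hP0 : P = 0 := by
      refine eq_zero_of_eventually_eval_eq_zero (hP.mono fun d hd => ?_)
      rw [← hd, hilb_top, Nat.cast_zero]
    refine ⟨fun d _ => by simp [hilb_top, hP0], fun d _ f _ hf => ?_⟩
    obtain ⟨g, hg, hfg⟩ := exists_eq_sum_mul_X hf
    exact ⟨g, fun k => ⟨Submodule.mem_top, hg k⟩, hfg⟩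
  -- The induction runs over all `P` at once, since a hyperplane section has the difference
  -- polynomial `P(d) - P(d - 1)`. The measure `hilb I 1` drops because `hilb I 0 ≥ 1` for a proper
  -- ideal.
  induction m with
  | zero =>
    intro P
    refine ⟨0, fun K _ _ I hI hsat h1 hP => htop P 0 K I ?_ hP⟩
    rw [Ideal.eq_top_iff_one]
    refine hsat 1 fun k => ?_
    have h0 : hilb I 1 = hilb (⊤ : Ideal (MvPolynomial σ K)) 1 := by rw [hilb_top]; omega
    exact mem_of_hilb_eq le_top h0 (by simpa using isHomogeneous_X K k) Submodule.mem_top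
  | succ m ih =>
    intro P
    obtain ⟨e, he⟩ := ih (P - P.comp (Polynomial.X - 1))
    -- `e` comes from the hyperplane section, and the ceiling bounds the number of times the defect
    -- `δ` can drop after degree `e`. The final 2 leaves room for index shifts.
    refine ⟨e + ⌈P.eval (e : ℚ)⌉₊ + 2, fun K _ _ I hI hsat h1 hP => ?_⟩
    by_cases hIt : I = ⊤
    · exact htop P _ K I hIt hP
    obtain ⟨l, hl, hl0, hreg⟩ := exists_linear_regular hsat hIt
    let J := I ⊔ Ideal.span {l}
    have hJ : IsGraded J := isGraded_sup_span hI hl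
    have hsec : ∀ d, (hilb J (d + 1) : ℚ) = hilb I (d + 1) - hilb I d := by
      intro d
      rw [← hilb_sup_span hI hl hl0 hreg d]
      push_cast
      ring
    have hΔ : ∀ d : ℕ, (P - P.comp (Polynomial.X - 1)).eval ((d + 1 : ℕ) : ℚ) =
        P.eval ((d + 1 : ℕ) : ℚ) - P.eval (d : ℚ) := by
      intro d
      simp
    have hJsat : ∀ d, hilb (sat J) d ≤ hilb J d := hilb_anti (le_sat J)
    obtain ⟨D, hD⟩ := exists_forall_mem_of_mem_sat hJ
    obtain ⟨hA, hB⟩ := he K (sat J) hJ.sat (isSaturated_sat J) (by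
      have h2 := hilb_sup_span hI hl hl0 hreg 0
      have h3 := hilb_zero_pos hIt
      have h4 := hJsat 1
      simp only [zero_add] at h2
      change hilb J 1 + _ = _ at h2
      omega) (by
      obtain ⟨D', hD'⟩ := Filter.eventually_atTop.mp hP
      refine Filter.eventually_atTop.mpr ⟨D + D' + 1, fun d hd => ?_⟩
      obtain ⟨d, rfl⟩ : ∃ d', d = d' + 1 := ⟨d - 1, by omega⟩
      rw [hΔ, ← hD' (d + 1) (by omega), ← hD' d (by omega), ← hsec]
      exact congrArg _ (hilb_congr fun f hf => ⟨hD _ (by omega) f hf, fun h => le_sat J h⟩))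
    -- The increment of the defect of `I` is minus the gap between `J` and its saturation, thus a
    -- nonpositive integer.
    let δ : ℕ → ℚ := fun d => P.eval (d : ℚ) - hilb I d
    have hδ : ∀ d ≥ e, δ (d + 1) - δ d = hilb (sat J) (d + 1) - hilb J (d + 1) := by
      intro d hd
      rw [hA (d + 1) (by omega), hΔ, hsec]
      simp only [δ]
      ring
    have hδJ : ∀ d ≥ e, δ (d + 1) = δ d → hilb J (d + 1) = hilb (sat J) (d + 1) := by
      intro d hd h
      have := hδ d hd
      rw [h, sub_self] at this
      have h3 : (hilb J (d + 1) : ℚ) = hilb (sat J) (d + 1) := by linarith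
      exact_mod_cast h3
    have hzero := eq_zero_of_decreasing (δ := δ) (e := e) (N := ⌈P.eval (e : ℚ)⌉₊)
      (fun d hd => by
        have h2 := hδ d hd
        rcases (hJsat (d + 1)).lt_or_eq with h | h
        · right
          have h3 : (hilb (sat J) (d + 1) : ℚ) + 1 ≤ hilb J (d + 1) := by exact_mod_cast h
          linarith
        · left
          rw [h] at h2
          linarith)
      -- A repeated value means that `J` equals its saturation in degree `d + 1`. The saturation has
      -- no new generators in degree `d + 2`, so equality persists there, and so does the value of
      -- `δ`.
      (fun d hd h => by
        have h2 := hδJ d hd h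
        have h3 : hilb J (d + 2) = hilb (sat J) (d + 2) := by
          refine hilb_congr fun f hf => ⟨fun h => le_sat J h, fun hfs => ?_⟩
          obtain ⟨g, hg, rfl⟩ := hB (d + 1) (by omega) f hfs hf
          exact J.sum_mem fun k _ => J.mul_mem_right _
            (mem_of_hilb_eq (le_sat J) h2 (hg k).2 (hg k).1)
        have h4 := hδ (d + 1) (by omega)
        rw [show d + 1 + 1 = d + 2 from rfl, h3] at h4
        linarith)
      (hP.mono fun d hd => by simp [δ, hd])
      (by
        have h2 := Nat.le_ceil (P.eval (e : ℚ))
        have h3 : (0 : ℚ) ≤ hilb I e := Nat.cast_nonneg _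
        simp only [δ]
        linarith)
    refine ⟨fun d hd => ?_, fun d hd f hf hfd => ?_⟩
    · have := hzero d (by omega)
      simp only [δ] at this
      linarith
    · obtain ⟨d, rfl⟩ : ∃ d', d = d' + 1 := ⟨d - 1, by omega⟩
      have hJd : hilb J (d + 1) = hilb (sat J) (d + 1) :=
        hδJ d (by omega) ((hzero (d + 1) (by omega)).trans (hzero d (by omega)).symm)
      obtain ⟨g, hg, hfg⟩ := hB (d + 1) (by omega) f (le_sat J (Ideal.mem_sup_left hf)) hfd
      have hgJ : ∀ k, ∃ a b : MvPolynomial σ K, a ∈ I ∧ a.IsHomogeneous (d + 1) ∧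
          b.IsHomogeneous d ∧ g k = a + b * l := fun k =>
        exists_of_mem_sup_span hI hl (hg k).2 (mem_of_hilb_eq (le_sat J) hJd (hg k).2 (hg k).1)
      choose a b ha had hb hgab using hgJ
      obtain ⟨c, hc, hlc⟩ := exists_eq_sum_mul_X hl
      let t := ∑ k, b k * X k
      have ht : t.IsHomogeneous (d + 1) :=
        IsHomogeneous.sum _ _ _ fun k _ => (hb k).mul (isHomogeneous_X K k)
      have hft : f = ∑ k, a k * X k + t * l := by
        rw [hfg, Finset.sum_mul, ← Finset.sum_add_distrib]
        refine Finset.sum_congr rfl fun k _ => ?_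
        rw [hgab]
        ring
      -- The remainder `t * l` lies in `I`, so `t` does by regularity. Writing `l` as a combination
      -- of the variables with constant coefficients turns `t * l` into a combination of variables
      -- with coefficients in `I`.
      have htI : t ∈ I := by
        refine hreg t ?_
        have : t * l = f - ∑ k, a k * X k := by rw [hft]; ring
        rw [this]
        exact sub_mem hf (I.sum_mem fun k _ => I.mul_mem_right _ (ha k))
      refine ⟨fun k => a k + t * c k, fun k => ⟨add_mem (ha k) (I.mul_mem_right _ htI),
        (had k).add (by simpa using ht.mul (hc k))⟩, ?_⟩
      rw [hft]
      conv_lhs => rw [hlc]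
      rw [Finset.mul_sum, ← Finset.sum_add_distrib]
      refine Finset.sum_congr rfl fun k _ => ?_
      ring

end UniformBound

section

/-! ### Extension of the base field -/

section FieldExtension

variable {σ K L : Type*} [Field K] [Field L] [Algebra K L]

theorem IsGraded.map {A B : Type*} [CommRing A] [CommRing B] (ρ : A →+* B)
    {I : Ideal (MvPolynomial σ A)} (hI : IsGraded I) : IsGraded (I.map (map ρ)) := by
  have : I.map (MvPolynomial.map ρ) =
      Ideal.span {g | ∃ f ∈ I, (∃ d, f.IsHomogeneous d) ∧ MvPolynomial.map ρ f = g} := by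
    apply le_antisymm
    · refine Ideal.map_le_iff_le_comap.mpr fun f hf => ?_
      rw [Ideal.mem_comap, ← sum_homogeneousComponent f, map_sum]
      exact Ideal.sum_mem _ fun e _ => Ideal.subset_span
        ⟨_, hI f hf e, ⟨e, homogeneousComponent_isHomogeneous _ _⟩, rfl⟩
    · rw [Ideal.span_le]
      rintro _ ⟨f, hf, -, rfl⟩
      exact Ideal.mem_map_of_mem _ hf
  rw [this]
  refine isGraded_span ?_
  rintro _ ⟨f, -, ⟨d, hd⟩, rfl⟩
  exact ⟨d, hd.map ρ⟩

/-- Apply a linear functional to the coefficients of a polynomial. -/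
def mapFunctional (φ : L →ₗ[K] K) (f : MvPolynomial σ L) : MvPolynomial σ K :=
  ∑ m ∈ f.support, monomial m (φ (coeff m f))

theorem coeff_mapFunctional (φ : L →ₗ[K] K) (f : MvPolynomial σ L) (m : σ →₀ ℕ) :
    coeff m (mapFunctional φ f) = φ (coeff m f) := by
  classical
  simp only [mapFunctional, coeff_sum, coeff_monomial, Finset.sum_ite_eq', mem_support_iff]
  split_ifs with h
  · rfl
  · rw [not_not.mp h, map_zero]

theorem mapFunctional_X_mul (φ : L →ₗ[K] K) (k : σ) (f : MvPolynomial σ L) :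
    mapFunctional φ (X k * f) = X k * mapFunctional φ f := by
  classical
  ext m
  rw [coeff_mapFunctional, coeff_X_mul', coeff_X_mul', coeff_mapFunctional]
  split_ifs <;> simp

/-- Functionals are `K`-linear, so on a monomial multiple of some `p ∈ I` only the new scalar is
affected, and it becomes an element of `K`. -/
theorem mapFunctional_mem (φ : L →ₗ[K] K) {I : Ideal (MvPolynomial σ K)} {f : MvPolynomial σ L}
    (hf : f ∈ I.map (map (algebraMap K L))) : mapFunctional φ f ∈ I := by
  have hadd : ∀ f g : MvPolynomial σ L,
      mapFunctional φ (f + g) = mapFunctional φ f + mapFunctional φ g := by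
    intro f g
    ext m
    simp [coeff_mapFunctional]
  suffices h : ∀ q, mapFunctional φ (q * f) ∈ I by simpa using h 1
  induction hf using Submodule.span_induction with
  | mem x hx =>
    obtain ⟨p, hp, rfl⟩ := hx
    intro q
    induction q using MvPolynomial.induction_on' with
    | monomial u a =>
      have h1 : mapFunctional φ (monomial u a * MvPolynomial.map (algebraMap K L) p) =
          C (φ a) * (monomial u 1 * p) := by
        have h2 : monomial u a * MvPolynomial.map (algebraMap K L) p =
            C a * MvPolynomial.map (algebraMap K L) (monomial u 1 * p) := by
          rw [map_mul, map_monomial, map_one, ← mul_assoc, C_mul_monomial, mul_one]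
        ext m
        rw [coeff_mapFunctional, h2, coeff_C_mul, coeff_C_mul, coeff_map, mul_comm a,
          ← Algebra.smul_def, map_smul, smul_eq_mul, mul_comm]
      rw [h1]
      exact I.mul_mem_left _ (I.mul_mem_left _ hp)
    | add a b ha hb => rw [add_mul, hadd]; exact add_mem ha hb
  | zero =>
    intro q
    have : mapFunctional φ (0 : MvPolynomial σ L) = 0 := by ext m; simp [coeff_mapFunctional]
    rw [mul_zero, this]
    exact zero_mem _
  | add x y _ _ hx hy => intro q; rw [mul_add, hadd]; exact add_mem (hx q) (hy q)
  | smul c x _ hx => intro q; rw [smul_eq_mul, ← mul_assoc]; exact hx _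

/-- Expand the coefficients of `f` in a `K`-basis of `L`: the coordinate functionals write `f` as an
`L`-combination of polynomials in `I`. With the previous lemma this tests membership in the extended
ideal over `K`. -/
theorem mem_map_of_forall_mapFunctional_mem {I : Ideal (MvPolynomial σ K)} {f : MvPolynomial σ L}
    (h : ∀ φ : L →ₗ[K] K, mapFunctional φ f ∈ I) : f ∈ I.map (map (algebraMap K L)) := by
  classical
  let b := Module.Basis.ofVectorSpace K L
  let s := f.support.biUnion fun m => (b.repr (coeff m f)).support
  have hf : f = ∑ j ∈ s, C (b j) * MvPolynomial.map (algebraMap K L)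
      (mapFunctional (b.coord j) f) := by
    ext m
    simp only [coeff_sum, coeff_C_mul, coeff_map, coeff_mapFunctional]
    by_cases hm : m ∈ f.support
    · conv_lhs => rw [← b.linearCombination_repr (coeff m f), Finsupp.linearCombination_apply]
      rw [Finsupp.sum_of_support_subset _ (Finset.subset_biUnion_of_mem
        (fun m => (b.repr (coeff m f)).support) hm) _ (by simp)]
      refine Finset.sum_congr rfl fun j _ => ?_
      rw [Algebra.smul_def, mul_comm]
      rfl
    · rw [notMem_support_iff.mp hm]
      simp
  rw [hf]
  exact Ideal.sum_mem _ fun j _ => Ideal.mul_mem_left _ _ (Ideal.mem_map_of_mem _ (h _))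

theorem IsSaturated.map {I : Ideal (MvPolynomial σ K)} (hI : IsSaturated I) :
    IsSaturated (I.map (map (algebraMap K L))) := by
  intro f hf
  refine mem_map_of_forall_mapFunctional_mem fun φ => hI _ fun k => ?_
  rw [← mapFunctional_X_mul]
  exact mapFunctional_mem φ (hf k)

theorem hilb_map [LinearOrder σ] [WellFoundedGT σ] {I : Ideal (MvPolynomial σ K)}
    (hI : IsGraded I) (d : ℕ) : hilb (I.map (map (algebraMap K L))) d = hilb I d := by
  obtain ⟨B, hB⟩ := exists_isStandard hI d
  rw [hB.hilb_eq, (hB.map (algebraMap K L) hI).hilb_eq]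

end FieldExtension

universe u v

/-- The algebraic closure supplies the infinite field needed for regular linear forms; neither
saturation nor the Hilbert function changes. The number of monomials of degree 1 bounds `hilb I 1`
for every ideal. -/
theorem exists_uniform_hilb_bound (σ : Type v) [Fintype σ] [LinearOrder σ] (P : Polynomial ℚ) :
    ∃ e : ℕ, ∀ (K : Type u) [Field K] (I : Ideal (MvPolynomial σ K)),
      IsGraded I → IsSaturated I →
      (∀ᶠ d : ℕ in Filter.atTop, (hilb I d : ℚ) = P.eval (d : ℚ)) →
      ∀ d ≥ e, (hilb I d : ℚ) = P.eval (d : ℚ) := by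
  obtain ⟨e, he⟩ := exists_uniform_bound.{u} σ (Nat.card {m : σ →₀ ℕ | m.degree = 1}) P
  refine ⟨e, fun K _ I hI hsat hP d hd => ?_⟩
  have hfin : {m : σ →₀ ℕ | m.degree = 1}.Finite := Finsupp.finite_of_degree_eq 1
  have h1 : hilb I 1 ≤ Nat.card {m : σ →₀ ℕ | m.degree = 1} := by
    obtain ⟨B, hB⟩ := exists_isStandard hI 1
    rw [hB.hilb_eq]
    exact Set.ncard_le_ncard hB.degree_eq hfin
  have h := he (AlgebraicClosure K) (I.map (map (algebraMap K (AlgebraicClosure K))))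
    (hI.map _) hsat.map
  simp only [hilb_map hI] at h
  exact (h h1 hP).1 d hd

/-! ### Hilbert function, saturation and primality of ultraproduct ideals -/

section UltraproductHilb

variable {S : Type*} (U : Ultrafilter S) {F : S → Type*} [∀ i, Field (F i)] {n : ℕ}

theorem map_ultraMk_eq_zero_iff {σ : Type*} (g : MvPolynomial σ (∀ i, F i)) :
    map (ultraMk U F) g = 0 ↔ ∀ᶠ i in (U : Filter S), map (Pi.evalRingHom F i) g = 0 := by
  have h : ∀ m, coeff m (map (ultraMk U F) g) = 0 ↔ ∀ᶠ i in (U : Filter S), coeff m g i = 0 := by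
    intro m
    rw [coeff_map]
    exact Ideal.Quotient.eq_zero_iff_mem
  constructor
  · intro hg
    have : ∀ m ∈ g.support, ∀ᶠ i in (U : Filter S), coeff m g i = 0 := by
      intro m _
      rw [← h, hg, coeff_zero]
    filter_upwards [(Filter.eventually_all_finset _).mpr this] with i hi
    ext m
    rw [coeff_map, coeff_zero]
    by_cases hm : m ∈ g.support
    · exact hi m hm
    · rw [notMem_support_iff.mp hm, map_zero]
  · intro hg
    ext m
    rw [coeff_zero, h]
    filter_upwards [hg] with i hi
    have := congrArg (coeff m) hi
    rwa [coeff_map, coeff_zero] at this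

/-- Łoś's principle for membership. The definition asks for a representative that is good at every
index, so a representative good almost everywhere is multiplied by the indicator `ε` of the good
indices, whose class is 1. -/
theorem map_mem_ultraproductIdeal_iff (J : ∀ i, HomogeneousIdeal (grading n (F i)))
    (g : MvPolynomial (Fin (n + 1)) (∀ i, F i)) :
    map (ultraMk U F) g ∈ (ultraproductIdeal U J).toIdeal ↔
      ∀ᶠ i in (U : Filter S), map (Pi.evalRingHom F i) g ∈ (J i).toIdeal := by
  classical
  refine (mem_map_iInf_iff U J _).trans ⟨?_, fun h => ?_⟩
  · rintro ⟨g', hg', h⟩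
    have h' : map (ultraMk U F) (g' - g) = 0 :=
      (map_sub (map (ultraMk U F)) g' g).trans (sub_eq_zero.mpr h)
    rw [map_ultraMk_eq_zero_iff] at h'
    filter_upwards [h'] with i hi
    rw [map_sub, sub_eq_zero] at hi
    exact hi ▸ hg' i
  · let ε : ∀ i, F i := fun i => if map (Pi.evalRingHom F i) g ∈ (J i).toIdeal then 1 else 0
    have hε : ultraMk U F ε = 1 := by
      rw [← map_one (ultraMk U F), Ideal.Quotient.eq]
      change ∀ᶠ i in (U : Filter S), _
      filter_upwards [h] with i hi
      exact sub_eq_zero.mpr (if_pos hi)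
    refine ⟨C ε * g, fun i => ?_, by rw [map_mul, map_C, hε, C_1, one_mul]⟩
    rw [map_mul, map_C]
    by_cases hi : map (Pi.evalRingHom F i) g ∈ (J i).toIdeal
    · exact Ideal.mul_mem_left _ _ hi
    · have h0 : Pi.evalRingHom F i ε = 0 := if_neg hi
      rw [h0, C_0, zero_mul]
      exact zero_mem _

theorem exists_lift_mem_restrictSupport {σ A B : Type*} [CommRing A] [CommRing B] {ρ : A →+* B}
    (hρ : Function.Surjective ρ) {s : Set (σ →₀ ℕ)} {f : MvPolynomial σ B}
    (hf : f ∈ restrictSupport B s) : ∃ g ∈ restrictSupport A s, map ρ g = f := by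
  rw [restrictSupport_eq_span] at hf
  induction hf using Submodule.span_induction with
  | mem x hx =>
    obtain ⟨m, hm, rfl⟩ := hx
    exact ⟨monomial m 1, (monomial_mem_restrictSupport A).mpr (Or.inl hm), by simp⟩
  | zero => exact ⟨0, zero_mem _, map_zero _⟩
  | add x y _ _ hx hy =>
    obtain ⟨a, ha, rfl⟩ := hx
    obtain ⟨b, hb, rfl⟩ := hy
    exact ⟨a + b, add_mem ha hb, map_add _ _ _⟩
  | smul c x _ hx =>
    obtain ⟨a, ha, rfl⟩ := hx
    obtain ⟨c, rfl⟩ := hρ c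
    exact ⟨c • a, Submodule.smul_mem _ _ ha, by simp [smul_eq_C_mul]⟩

theorem map_mem_restrictSupport {σ A B : Type*} [CommRing A] [CommRing B] (ρ : A →+* B)
    {s : Set (σ →₀ ℕ)} {f : MvPolynomial σ A} (hf : f ∈ restrictSupport A s) :
    map ρ f ∈ restrictSupport B s := by
  classical
  rw [mem_restrictSupport_iff] at hf ⊢
  exact (Finset.coe_subset.mpr (support_map_subset ρ f)).trans hf

theorem isGraded_toIdeal {A : Type*} [CommRing A] (I : HomogeneousIdeal (grading n A)) :
    IsGraded I.toIdeal := fun _ hf d => component_mem I d hf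

/-- Choose a monomial basis for each `i`. There are only finitely many sets of monomials of degree
`d`, so almost every `i` has the same one, and it is then a basis for the ultraproduct too. The set
of good indices depends on `d`. -/
theorem eventually_hilb_eq (J : ∀ i, HomogeneousIdeal (grading n (F i))) (d : ℕ) :
    ∀ᶠ i in (U : Filter S),
      hilb (J i).toIdeal d = hilb (ultraproductIdeal U J).toIdeal d := by
  classical
  have hfin : {m : Fin (n + 1) →₀ ℕ | m.degree = d}.Finite := Finsupp.finite_of_degree_eq d
  choose B hB using fun i => exists_isStandard (isGraded_toIdeal (J i)) d
  obtain ⟨D, hD, hDB⟩ : ∃ D ∈ {D : Set (Fin (n + 1) →₀ ℕ) | D ⊆ {m | m.degree = d}},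
      ∀ᶠ i in (U : Filter S), B i = D := by
    have := (Ultrafilter.eventually_exists_mem_iff (f := U)
      (P := fun D i => B i = D) hfin.finite_subsets).mp
      (Filter.Eventually.of_forall fun i => ⟨B i, (hB i).degree_eq, rfl⟩)
    exact this
  have hstd : IsStandard (ultraproductIdeal U J).toIdeal d D := by
    refine ⟨hD, fun m hm => ?_, fun g hg hgJ => ?_⟩
    · have h1 : ∀ i, ∃ g ∈ restrictSupport (F i) (B i), monomial m 1 - g ∈ (J i).toIdeal :=
        fun i => (hB i).exists_monomial_sub_mem m hm
      choose g hg hgJ using h1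
      -- `G` records the coefficients of the normal forms `g i` along `D`; it specialises to `g i`
      -- wherever `B i = D`.
      let G : MvPolynomial (Fin (n + 1)) (∀ i, F i) :=
        ∑ b ∈ (hfin.subset hD).toFinset, monomial b fun i => coeff b (g i)
      have hG : G ∈ restrictSupport (∀ i, F i) D :=
        Submodule.sum_mem _ fun b hb => (monomial_mem_restrictSupport _).mpr
          (Or.inl ((hfin.subset hD).mem_toFinset.mp hb))
      refine ⟨map (ultraMk U F) G, map_mem_restrictSupport _ hG, ?_⟩
      have h2 : monomial m 1 - map (ultraMk U F) G = map (ultraMk U F) (monomial m 1 - G) := by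
        simp
      rw [h2, map_mem_ultraproductIdeal_iff]
      filter_upwards [hDB] with i hi
      have h3 : map (Pi.evalRingHom F i) G = g i := by
        ext c
        simp only [G, map_sum, map_monomial, coeff_sum, coeff_monomial, Finset.sum_ite_eq',
          Set.Finite.mem_toFinset]
        split_ifs with hc
        · rfl
        · by_contra hne
          exact hc (hi ▸ hg i (mem_support_iff.mpr (Ne.symm hne)))
      rw [map_sub, map_monomial, map_one, h3]
      exact hgJ i
    · obtain ⟨g, hgD, rfl⟩ := exists_lift_mem_restrictSupport (ρ := ultraMk U F)
        Ideal.Quotient.mk_surjective hg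
      rw [map_mem_ultraproductIdeal_iff] at hgJ
      rw [map_ultraMk_eq_zero_iff]
      filter_upwards [hgJ, hDB] with i hi hiD
      exact (hB i).eq_zero _ (hiD ▸ map_mem_restrictSupport _ hgD) hi
  filter_upwards [hDB] with i hi
  rw [(hB i).hilb_eq, hstd.hilb_eq, hi]

theorem isSaturated_ultraproductIdeal {J : ∀ i, HomogeneousIdeal (grading n (F i))}
    (hJ : ∀ i, IsSaturated (J i).toIdeal) : IsSaturated (ultraproductIdeal U J).toIdeal := by
  intro f hf
  obtain ⟨g, rfl⟩ := map_surjective (ultraMk U F) Ideal.Quotient.mk_surjective f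
  have h : ∀ k, ∀ᶠ i in (U : Filter S), X k * map (Pi.evalRingHom F i) g ∈ (J i).toIdeal := by
    intro k
    have := hf k
    rw [← map_X (ultraMk U F), ← map_mul, map_mem_ultraproductIdeal_iff] at this
    simpa using this
  rw [map_mem_ultraproductIdeal_iff]
  filter_upwards [Filter.eventually_all.mpr h] with i hi
  exact hJ i _ hi

theorem isPrime_ultraproductIdeal {J : ∀ i, HomogeneousIdeal (grading n (F i))}
    (hJ : ∀ᶠ i in (U : Filter S), (J i).toIdeal.IsPrime) :
    (ultraproductIdeal U J).toIdeal.IsPrime := by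
  refine ⟨?_, ?_⟩
  · rw [Ne, Ideal.eq_top_iff_one, ← map_one (map (ultraMk U F)), map_mem_ultraproductIdeal_iff]
    intro h
    obtain ⟨i, h1, h2⟩ := (h.and hJ).exists
    rw [map_one] at h1
    exact h2.ne_top ((Ideal.eq_top_iff_one _).mpr h1)
  · intro x y hxy
    obtain ⟨a, rfl⟩ := map_surjective (ultraMk U F) Ideal.Quotient.mk_surjective x
    obtain ⟨b, rfl⟩ := map_surjective (ultraMk U F) Ideal.Quotient.mk_surjective y
    rw [← map_mul, map_mem_ultraproductIdeal_iff] at hxy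
    rw [map_mem_ultraproductIdeal_iff, map_mem_ultraproductIdeal_iff, ← Ultrafilter.eventually_or]
    filter_upwards [hxy, hJ] with i hi hp
    rw [map_mul] at hi
    exact hp.mem_or_mem hi

end UltraproductHilb

end

/-! ### Dehomogenisation and change of charts in the coordinate rings -/

section Charts

variable {n : ℕ} {R : Type*} [CommRing R]

/-- The localisation map away from a variable. -/
abbrev toLoc (k : Fin (n + 1)) : MvPolynomial (Fin (n + 1)) R →+*
    Localization.Away (X k : MvPolynomial (Fin (n + 1)) R) := algebraMap _ _

theorem isUnit_toLoc (k : Fin (n + 1)) : IsUnit (toLoc k (X k : MvPolynomial (Fin (n + 1)) R)) :=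
  IsLocalization.Away.algebraMap_isUnit _

theorem val_chartCoord_mul (k j : Fin (n + 1)) :
    (chartCoord k j : ChartRing n R k).val * toLoc k (X k) = toLoc k (X j) := by
  rw [chartCoord, HomogeneousLocalization.Away.val_mk, Localization.mk_eq_mk']
  have h : toLoc k (X k : MvPolynomial (Fin (n + 1)) R) = toLoc k (X k ^ 1) := by rw [pow_one]
  rw [h]
  exact IsLocalization.mk'_spec (Localization (Submonoid.powers (X k :
    MvPolynomial (Fin (n + 1)) R))) (X j : MvPolynomial (Fin (n + 1)) R)
    (⟨X k ^ 1, 1, rfl⟩ : Submonoid.powers (X k))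

theorem val_chartScalar (k : Fin (n + 1)) (c : R) :
    (chartScalar k c : ChartRing n R k).val = toLoc k (C c) := by
  rw [chartScalar, RingHom.comp_apply]
  change Localization.mk (C c) 1 = _
  rw [Localization.mk_one_eq_algebraMap]

theorem val_prod {ι : Type*} (s : Finset ι) (k : Fin (n + 1)) (a : ι → ChartRing n R k) :
    (∏ j ∈ s, a j).val = ∏ j ∈ s, (a j).val := by
  classical
  induction s using Finset.induction_on with
  | empty => simp
  | insert j s hj ih =>
    rw [Finset.prod_insert hj, Finset.prod_insert hj, HomogeneousLocalization.val_mul, ih]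

theorem val_dehomogenize_mul (k : Fin (n + 1)) {d : ℕ} {f : MvPolynomial (Fin (n + 1)) R}
    (hf : f.IsHomogeneous d) :
    (dehomogenize k f).val * toLoc k (X k) ^ d = toLoc k f := by
  rw [← mem_homogeneousSubmodule, homogeneousSubmodule_eq_span] at hf
  induction hf using Submodule.span_induction with
  | mem x hx =>
    obtain ⟨m, hm, rfl⟩ := hx
    have hm' : m.degree = d := hm
    have h1 : (dehomogenize k (monomial m (1 : R))) = ∏ j, (chartCoord k j) ^ m j := by
      rw [dehomogenize, coe_eval₂Hom, eval₂_monomial, map_one, one_mul]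
      exact Finsupp.prod_fintype _ _ (by simp)
    have h2 : (monomial m (1 : R)) = ∏ j, X j ^ m j := by
      rw [monomial_eq, C_1, one_mul]
      exact Finsupp.prod_fintype _ _ (by simp)
    dsimp only
    rw [h1, h2, ← hm', Finsupp.degree_eq_sum, ← Finset.prod_pow_eq_pow_sum,
      val_prod, ← Finset.prod_mul_distrib, map_prod]
    refine Finset.prod_congr rfl fun j _ => ?_
    rw [HomogeneousLocalization.val_pow, ← mul_pow, val_chartCoord_mul, map_pow]
  | zero => simp
  | add x y _ _ hx hy => rw [map_add, HomogeneousLocalization.val_add, add_mul, hx, hy, map_add]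
  | smul c x _ hx =>
    rw [smul_eq_C_mul, map_mul, HomogeneousLocalization.val_mul, mul_assoc, hx, map_mul]
    congr 1
    rw [dehomogenize, coe_eval₂Hom, eval₂_C, val_chartScalar]

theorem dehomogenize_X_self (k : Fin (n + 1)) :
    dehomogenize k (X k : MvPolynomial (Fin (n + 1)) R) = 1 := by
  apply HomogeneousLocalization.val_injective
  have h1 := val_dehomogenize_mul k (isHomogeneous_X R k)
  rw [pow_one] at h1
  rw [HomogeneousLocalization.val_one]
  refine (isUnit_toLoc (R := R) k).mul_right_cancel ?_
  rw [h1, one_mul]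

theorem dehomogenize_surjective (k : Fin (n + 1)) (a : ChartRing n R k) :
    ∃ (d : ℕ) (f : MvPolynomial (Fin (n + 1)) R), f.IsHomogeneous d ∧ dehomogenize k f = a := by
  obtain ⟨d, f, hf, rfl⟩ := HomogeneousLocalization.Away.mk_surjective _ (X_mem_grading k) a
  have hf' : f.IsHomogeneous d := by simpa using hf
  refine ⟨d, f, hf', HomogeneousLocalization.val_injective _ ?_⟩
  refine ((isUnit_toLoc (R := R) k).pow d).mul_right_cancel ?_
  rw [val_dehomogenize_mul k hf', HomogeneousLocalization.Away.val_mk, Localization.mk_eq_mk',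
    ← map_pow]
  exact (IsLocalization.mk'_spec _ f (⟨X k ^ d, d, rfl⟩ : Submonoid.powers (X k))).symm

theorem exists_pow_mul_eq_zero (k : Fin (n + 1)) {d : ℕ} {f : MvPolynomial (Fin (n + 1)) R}
    (hf : f.IsHomogeneous d) (h : dehomogenize k f = 0) : ∃ N, X k ^ N * f = 0 := by
  have h1 := val_dehomogenize_mul k hf
  rw [h, HomogeneousLocalization.val_zero, zero_mul] at h1
  obtain ⟨⟨_, N, rfl⟩, hN⟩ := (IsLocalization.map_eq_zero_iff (.powers (X k)) _ _).mp h1.symm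
  exact ⟨N, hN⟩

theorem val_awayMap_dehomogenize_mul (k : Fin (n + 1)) {e : ℕ}
    {g x : MvPolynomial (Fin (n + 1)) R} (hg : g ∈ grading n R e) (hx : x = X k * g) {d : ℕ}
    {f : MvPolynomial (Fin (n + 1)) R} (hf : f.IsHomogeneous d) :
    (HomogeneousLocalization.awayMap (grading n R) hg hx (dehomogenize k f)).val *
      algebraMap (MvPolynomial (Fin (n + 1)) R) (Localization.Away x) (X k) ^ d =
        algebraMap (MvPolynomial (Fin (n + 1)) R) (Localization.Away x) f := by
  rw [HomogeneousLocalization.val_awayMap]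
  have hu : IsUnit (algebraMap (MvPolynomial (Fin (n + 1)) R) (Localization.Away x) (X k)) :=
    isUnit_of_dvd_unit (map_dvd _ ⟨_, hx⟩) (IsLocalization.Away.algebraMap_isUnit x)
  have h := congrArg (Localization.awayLift (algebraMap _ (Localization.Away x)) (X k) hu)
    (val_dehomogenize_mul k hf)
  have h2 : ∀ a, Localization.awayLift (algebraMap _ (Localization.Away x)) (X k) hu
      (toLoc k a) = algebraMap _ (Localization.Away x) a :=
    fun a => IsLocalization.Away.lift_eq (X k) hu a
  rwa [map_mul, map_pow, h2, h2] at h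

/-- This is the identity f/xⱼᵈ = (f/xₖᵈ)(xₖ/xⱼ)ᵈ on the overlap, checked in the localisation at xₖxⱼ
after clearing xⱼᵈ. -/
theorem awayMap_dehomogenize (k j : Fin (n + 1)) {d : ℕ}
    {f : MvPolynomial (Fin (n + 1)) R} (hf : f.IsHomogeneous d) :
    HomogeneousLocalization.awayMap (grading n R) (X_mem_grading k)
      (mul_comm (X k : MvPolynomial (Fin (n + 1)) R) (X j)) (dehomogenize j f) =
    HomogeneousLocalization.awayMap (grading n R) (X_mem_grading j) rfl (dehomogenize k f) *
      HomogeneousLocalization.awayMap (grading n R) (X_mem_grading k)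
        (mul_comm (X k : MvPolynomial (Fin (n + 1)) R) (X j)) (dehomogenize j (X k)) ^ d := by
  apply HomogeneousLocalization.val_injective
  have h1 := val_awayMap_dehomogenize_mul j (X_mem_grading k)
    (mul_comm (X k : MvPolynomial (Fin (n + 1)) R) (X j)) hf
  have h2 := val_awayMap_dehomogenize_mul k (X_mem_grading j) rfl hf
  have h3 := val_awayMap_dehomogenize_mul j (X_mem_grading k)
    (mul_comm (X k : MvPolynomial (Fin (n + 1)) R) (X j)) (isHomogeneous_X R k)
  have hu : IsUnit (algebraMap (MvPolynomial (Fin (n + 1)) R)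
      (Localization.Away (X k * X j : MvPolynomial (Fin (n + 1)) R)) (X j)) :=
    isUnit_of_dvd_unit (map_dvd _ ⟨X k, mul_comm _ _⟩)
      (IsLocalization.Away.algebraMap_isUnit _)
  rw [pow_one] at h3
  refine (hu.pow d).mul_right_cancel ?_
  rw [h1, HomogeneousLocalization.val_mul, HomogeneousLocalization.val_pow, mul_assoc, ← mul_pow,
    h3, h2]

theorem awayMap_mem_map_iff (k j : Fin (n + 1)) (I : Ideal (ChartRing n R k))
    {t : ChartRing n R k}
    (ht : HomogeneousLocalization.awayMap (grading n R) (X_mem_grading j)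
      (rfl : (X k * X j : MvPolynomial (Fin (n + 1)) R) = _) t ∈
      I.map (HomogeneousLocalization.awayMap (grading n R) (X_mem_grading j) rfl)) :
    ∃ N, dehomogenize k (X j) ^ N * t ∈ I := by
  let _ := (HomogeneousLocalization.awayMap (grading n R) (X_mem_grading j)
      (rfl : (X k * X j : MvPolynomial (Fin (n + 1)) R) = _)).toAlgebra
  have hloc := HomogeneousLocalization.Away.isLocalization_mul (X_mem_grading (R := R) k)
    (X_mem_grading j) rfl one_ne_zero
  obtain ⟨_, ⟨N, rfl⟩, hN⟩ := (IsLocalization.algebraMap_mem_map_algebraMap_iff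
    (Submonoid.powers (HomogeneousLocalization.Away.isLocalizationElem
      (X_mem_grading (R := R) k) (X_mem_grading j))) _ I t).mp ht
  refine ⟨N, ?_⟩
  have : HomogeneousLocalization.Away.isLocalizationElem (X_mem_grading (R := R) k)
      (X_mem_grading j) = dehomogenize k (X j) := by
    apply HomogeneousLocalization.val_injective
    refine (isUnit_toLoc k).mul_right_cancel ?_
    have h1 := val_dehomogenize_mul k (isHomogeneous_X R j)
    rw [pow_one] at h1
    rw [h1, HomogeneousLocalization.Away.isLocalizationElem,
      HomogeneousLocalization.Away.val_mk, Localization.mk_eq_mk']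
    have h : ∀ i, toLoc k (X i : MvPolynomial (Fin (n + 1)) R) = toLoc k (X i ^ 1) := fun i => by
      rw [pow_one]
    rw [h k, h j]
    exact IsLocalization.mk'_spec (Localization (Submonoid.powers (X k :
      MvPolynomial (Fin (n + 1)) R))) ((X j : MvPolynomial (Fin (n + 1)) R) ^ 1)
      (⟨X k ^ 1, 1, rfl⟩ : Submonoid.powers (X k))
  rw [← this]
  exact hN

end Charts

/-! ### Homogeneous polynomials as functions on the charts of projective space -/

section

open CategoryTheory Opposite

section Charts

universe u

variable {n : ℕ} {R : Type u} [CommRing R]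

theorem dehomogenize_mem_map_iff {J : Ideal (MvPolynomial (Fin (n + 1)) R)} (hJ : IsGraded J)
    (k : Fin (n + 1)) {d : ℕ} {f : MvPolynomial (Fin (n + 1)) R} (hf : f.IsHomogeneous d) :
    dehomogenize k f ∈ J.map (dehomogenize k) ↔ ∃ N, X k ^ N * f ∈ J := by
  have hsurj : Function.Surjective (dehomogenize (R := R) k) := fun a => by
    obtain ⟨_, f, -, h⟩ := dehomogenize_surjective k a
    exact ⟨f, h⟩
  constructor
  · intro h
    obtain ⟨g, hg, hgf⟩ := (Ideal.mem_map_iff_of_surjective _ hsurj).mp h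
    let D := g.totalDegree
    -- Rehomogenisation: every component of `g` is padded to degree `D` by powers of `X k`, which
    -- dehomogenise to 1. Then `X k ^ D * f` and `X k ^ d * g'` have equal degree and equal
    -- dehomogenisation, so a power of `X k` kills their difference.
    let g' := ∑ e ∈ Finset.range (D + 1), X k ^ (D - e) * homogeneousComponent e g
    have hg' : g'.IsHomogeneous D := by
      refine IsHomogeneous.sum _ _ _ fun e he => ?_
      have := (isHomogeneous_X_pow (R := R) k (D - e)).mul (homogeneousComponent_isHomogeneous e g)
      rwa [Nat.sub_add_cancel (Nat.lt_succ_iff.mp (Finset.mem_range.mp he))] at this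
    have hg'J : g' ∈ J := J.sum_mem fun e _ => J.mul_mem_left _ (hJ g hg e)
    have hdeh : dehomogenize k g' = dehomogenize k f := by
      rw [← hgf]
      conv_rhs => rw [← sum_homogeneousComponent g]
      simp only [g', map_sum, map_mul, map_pow, dehomogenize_X_self, one_pow, one_mul]
      rfl
    have hhom : (X k ^ D * f - X k ^ d * g').IsHomogeneous (D + d) := by
      refine ((isHomogeneous_X_pow k D).mul hf).sub ?_
      exact add_comm d D ▸ (isHomogeneous_X_pow k d).mul hg'
    obtain ⟨N, hN⟩ := exists_pow_mul_eq_zero k hhom (by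
      simp only [map_sub, map_mul, map_pow, dehomogenize_X_self, one_pow, one_mul, hdeh, sub_self])
    refine ⟨N + D, ?_⟩
    have : X k ^ (N + D) * f = X k ^ N * (X k ^ d * g') := by
      linear_combination hN
    rw [this]
    exact J.mul_mem_left _ (J.mul_mem_left _ hg'J)
  · rintro ⟨N, hN⟩
    have := Ideal.mem_map_of_mem (dehomogenize k) hN
    rwa [map_mul, map_pow, dehomogenize_X_self, one_pow, one_mul] at this

/-- Functions on the chart `D₊(xₖ)` are the elements of the chart ring. -/
def chartEquiv (k : Fin (n + 1)) : ChartRing n R k ≃+* Γ(ProjectiveSpace n R, (chart k).1) :=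
  (Proj.basicOpenIsoAway (grading n R) (X k) (X_mem_grading k) one_pos).commRingCatIsoToRingEquiv

theorem toChart_apply (k : Fin (n + 1)) (f : MvPolynomial (Fin (n + 1)) R) :
    toChart k f = chartEquiv k (dehomogenize k f) := rfl

theorem toChart_X_self (k : Fin (n + 1)) :
    toChart k (X k : MvPolynomial (Fin (n + 1)) R) = 1 := by
  rw [toChart_apply, dehomogenize_X_self, map_one]

theorem toChart_surjective (k : Fin (n + 1)) (a : Γ(ProjectiveSpace n R, (chart k).1)) :
    ∃ (d : ℕ) (f : MvPolynomial (Fin (n + 1)) R), f.IsHomogeneous d ∧ toChart k f = a := by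
  obtain ⟨d, f, hf, h⟩ := dehomogenize_surjective k ((chartEquiv k).symm a)
  exact ⟨d, f, hf, by rw [toChart_apply, h, RingEquiv.apply_symm_apply]⟩

theorem map_toChart (J : Ideal (MvPolynomial (Fin (n + 1)) R)) (k : Fin (n + 1)) :
    J.map (toChart k) = (J.map (dehomogenize k)).map (chartEquiv k).toRingHom := by
  rw [Ideal.map_map]
  rfl

theorem toChart_mem_map_iff {J : Ideal (MvPolynomial (Fin (n + 1)) R)} (hJ : IsGraded J)
    (k : Fin (n + 1)) {d : ℕ} {f : MvPolynomial (Fin (n + 1)) R} (hf : f.IsHomogeneous d) :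
    toChart k f ∈ J.map (toChart k) ↔ ∃ N, X k ^ N * f ∈ J := by
  rw [← dehomogenize_mem_map_iff hJ k hf, map_toChart, toChart_apply]
  constructor
  · intro h
    obtain ⟨b, hb, hbf⟩ := (Ideal.mem_map_iff_of_surjective _ (chartEquiv k).surjective).mp h
    rwa [← (chartEquiv k).injective hbf]
  · exact Ideal.mem_map_of_mem _

theorem iSup_chart : ⨆ k, (chart (n := n) (R := R) k).1 = ⊤ := by
  refine Proj.iSup_basicOpen_eq_top' _ _ (fun k => ⟨1, X_mem_grading k⟩) ?_
  rw [eq_top_iff]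
  intro f _
  induction f using MvPolynomial.induction_on with
  | C a =>
    exact Subalgebra.algebraMap_mem (Algebra.adjoin (grading n R 0) _)
      ⟨C a, isHomogeneous_C _ _⟩
  | add p q hp hq => exact add_mem (hp trivial) (hq trivial)
  | mul_X p j hp => exact mul_mem (hp trivial) (Algebra.subset_adjoin ⟨j, rfl⟩)

/-- Restriction of functions on `ℙⁿ`. -/
abbrev res {U V : (ProjectiveSpace n R).Opens} (h : U ≤ V) :
    Γ(ProjectiveSpace n R, V) →+* Γ(ProjectiveSpace n R, U) :=
  ((ProjectiveSpace n R).presheaf.map (homOfLE h).op).hom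

theorem res_res {U V W : (ProjectiveSpace n R).Opens} (h : U ≤ V) (h' : V ≤ W)
    (a : Γ(ProjectiveSpace n R, W)) : res h (res h' a) = res (h.trans h') a := by
  rw [res, res, ← RingHom.comp_apply, ← CommRingCat.hom_comp, ← Functor.map_comp]
  rfl

/-- The overlap of two charts. -/
abbrev overlap (k j : Fin (n + 1)) : (ProjectiveSpace n R).affineOpens :=
  ⟨Proj.basicOpen (grading n R) (X k * X j), Proj.isAffineOpen_basicOpen (grading n R) _
    (SetLike.mul_mem_graded (X_mem_grading k) (X_mem_grading j)) (by norm_num)⟩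

theorem overlap_le_left (k j : Fin (n + 1)) :
    (overlap (R := R) k j).1 ≤ (chart k).1 := Proj.basicOpen_mono _ _ _ ⟨_, rfl⟩

theorem overlap_le_right (k j : Fin (n + 1)) :
    (overlap (R := R) k j).1 ≤ (chart j).1 := Proj.basicOpen_mono _ _ _ ⟨_, mul_comm _ _⟩

/-- Functions on the overlap of two charts. -/
def overlapEquiv (k j : Fin (n + 1)) :
    HomogeneousLocalization.Away (grading n R) (X k * X j) ≃+*
      Γ(ProjectiveSpace n R, (overlap k j).1) :=
  (Proj.basicOpenIsoAway (grading n R) (X k * X j)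
    (SetLike.mul_mem_graded (X_mem_grading k) (X_mem_grading j))
    (by norm_num)).commRingCatIsoToRingEquiv

theorem overlapEquiv_left (k j : Fin (n + 1)) (a : ChartRing n R k) :
    overlapEquiv k j (HomogeneousLocalization.awayMap (grading n R) (X_mem_grading j) rfl a) =
      res (overlap_le_left k j) (chartEquiv k a) :=
  congr($(Proj.awayMap_awayToSection (grading n R) (f := X k) (X_mem_grading j) rfl).hom a)

theorem overlapEquiv_right (k j : Fin (n + 1)) (a : ChartRing n R j) :
    overlapEquiv k j (HomogeneousLocalization.awayMap (grading n R) (X_mem_grading k)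
      (mul_comm _ _) a) = res (overlap_le_right k j) (chartEquiv j a) :=
  congr($(Proj.awayMap_awayToSection (grading n R) (f := X j) (X_mem_grading k)
    (mul_comm (X k) (X j))).hom a)

/-- The change of charts for homogeneous polynomials. -/
theorem res_toChart (k j : Fin (n + 1)) {d : ℕ} {f : MvPolynomial (Fin (n + 1)) R}
    (hf : f.IsHomogeneous d) {W : (ProjectiveSpace n R).Opens} (hk : W ≤ (chart k).1)
    (hj : W ≤ (chart j).1) :
    res hj (toChart j f) = res hk (toChart k f) * res hj (toChart j (X k)) ^ d := by
  have hW : W ≤ (overlap k j).1 :=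
    (le_inf hk hj).trans (Proj.basicOpen_mul (grading n R) (X k) (X j)).ge
  have h := congrArg (overlapEquiv k j) (awayMap_dehomogenize k j hf)
  rw [map_mul, map_pow, overlapEquiv_left, overlapEquiv_right, overlapEquiv_right] at h
  have h' := congrArg (res hW) h
  rwa [map_mul, map_pow, res_res, res_res, res_res] at h'

theorem mem_homogeneousIdeal_iff (Y : ClosedSubscheme n R) {d : ℕ}
    {f : MvPolynomial (Fin (n + 1)) R} (hf : f.IsHomogeneous d) :
    f ∈ (homogeneousIdeal Y).toIdeal ↔ ∀ k, toChart k f ∈ Y.ideal (chart k) := by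
  have key : f ∈ (⨅ k, (Y.ideal (chart k)).comap (toChart k)) ↔
      ∀ k, toChart k f ∈ Y.ideal (chart k) := by
    simp only [Ideal.mem_iInf, Ideal.mem_comap]
  rw [← key]
  exact ⟨fun h => Ideal.toIdeal_homogeneousCore_le _ _ h,
    fun h => Ideal.mem_homogeneousCore_of_homogeneous_of_mem ⟨d, hf⟩ h⟩

theorem isSaturated_homogeneousIdeal (Y : ClosedSubscheme n R) :
    IsSaturated (homogeneousIdeal Y).toIdeal := by
  intro f hf
  rw [← sum_homogeneousComponent f]
  refine Ideal.sum_mem _ fun d _ => ?_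
  have hd := homogeneousComponent_isHomogeneous d f
  refine (mem_homogeneousIdeal_iff Y hd).mpr fun k => ?_
  have h := isGraded_toIdeal (homogeneousIdeal Y) _ (hf k) (d + 1)
  rw [mul_comm, homogeneousComponent_mul_of_isHomogeneous (isHomogeneous_X R k),
    if_pos (Nat.le_add_left _ _), Nat.add_sub_cancel] at h
  have h' := (mem_homogeneousIdeal_iff Y (hd.mul (isHomogeneous_X R k))).mp h k
  rwa [map_mul, toChart_X_self, mul_one] at h'

/-- On the overlap, vanishing in one chart implies vanishing in the other. By quasi-coherence the
ideal on the overlap is the localisation of the ideal on chart `j` at xₖ/xⱼ, so a power of this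
function clears the denominators. -/
theorem exists_toChart_pow_mul_mem (Y : ClosedSubscheme n R) (k j : Fin (n + 1)) {d : ℕ}
    {f : MvPolynomial (Fin (n + 1)) R} (hf : f.IsHomogeneous d)
    (h : toChart k f ∈ Y.ideal (chart k)) :
    ∃ N, toChart j (X k ^ N * f) ∈ Y.ideal (chart j) := by
  have h1 : res (overlap_le_right j k) (toChart k f) ∈ Y.ideal (overlap j k) :=
    Y.ideal_le_comap_ideal (V := chart k) (overlap_le_right j k) h
  have h2 : res (overlap_le_left j k) (toChart j f) ∈ Y.ideal (overlap j k) := by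
    rw [res_toChart k j hf (overlap_le_right j k) (overlap_le_left j k)]
    exact Ideal.mul_mem_right _ _ h1
  rw [← Y.map_ideal (V := chart j) (overlap_le_left j k)] at h2
  obtain ⟨N, hN⟩ := awayMap_mem_map_iff j k ((Y.ideal (chart j)).comap (chartEquiv j).toRingHom)
    (t := dehomogenize j f) (by
      have h3 : (Y.ideal (chart j)).map (res (overlap_le_left j k)) =
          (((Y.ideal (chart j)).comap (chartEquiv j).toRingHom).map
            (HomogeneousLocalization.awayMap (grading n R) (X_mem_grading k) rfl)).map
            (overlapEquiv j k).toRingHom := by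
        conv_lhs => rw [← Ideal.map_comap_of_surjective (chartEquiv j).toRingHom
          (chartEquiv j).surjective (Y.ideal (chart j))]
        rw [Ideal.map_map, Ideal.map_map]
        congr 1
        ext a : 1
        exact (overlapEquiv_left j k a).symm
      have h4 := h2
      erw [h3] at h4
      obtain ⟨b, hb, hbf⟩ := (Ideal.mem_map_iff_of_surjective _
        (overlapEquiv j k).surjective).mp h4
      have h5 := (overlapEquiv_left j k (dehomogenize j f)).trans hbf.symm
      rwa [(overlapEquiv j k).injective h5])
  refine ⟨N, ?_⟩
  rw [toChart_apply, map_mul, map_pow]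
  exact hN

end Charts

end

/-! ### Closures of affine pieces -/

section

open CategoryTheory Opposite

section Closure

universe u

variable {n : ℕ} {R : Type u} [CommRing R]

/-- The open immersion of the standard affine chart. -/
abbrev chartι (k : Fin (n + 1)) : Spec (.of (ChartRing n R k)) ⟶ ProjectiveSpace n R :=
  Proj.awayι (grading n R) (X k) (X_mem_grading k) one_pos

theorem chartι_preimage (k : Fin (n + 1)) : chartι (R := R) k ⁻¹ᵁ (chart k).1 = ⊤ :=
  (congrArg (chartι (R := R) k ⁻¹ᵁ ·) (Proj.opensRange_awayι (grading n R) (X k)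
    (X_mem_grading k) one_pos).symm).trans (Scheme.Hom.preimage_opensRange _)

/-- Compatibility of the identification of functions on D₊(xₖ) with the chart immersion; it lets
vanishing on `affineι` be tested by membership in an ideal of the chart ring. -/
theorem awayToSection_chartι (k : Fin (n + 1)) :
    Proj.awayToSection (grading n R) (X k) ≫
      (chartι (R := R) k).appLE (chart k).1 ⊤ (chartι_preimage k).ge =
    (Scheme.ΓSpecIso _).inv := by
  let e := Proj.basicOpenIsoSpec (grading n R) (X k) (X_mem_grading k) one_pos
  have h : e.hom.appTop = (Scheme.ΓSpecIso _).hom ≫ Proj.awayToSection (grading n R) (X k) ≫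
      (Proj.basicOpen (grading n R) (X k)).topIso.inv :=
    Proj.basicOpenToSpec_app_top (grading n R) (X k)
  have h1 : (chartι (R := R) k).appLE (chart k).1 ⊤ (chartι_preimage k).ge =
      (Proj.basicOpen (grading n R) (X k)).topIso.inv ≫ e.inv.appTop := by
    have := Scheme.Hom.appLE_comp_appLE e.inv (Proj.basicOpen (grading n R) (X k)).ι
      (chart k).1 ⊤ ⊤ (by simp) le_rfl
    refine this.symm.trans ?_
    rw [Scheme.Opens.ι_appLE]
    congr 1
  have h2 : Proj.awayToSection (grading n R) (X k) ≫
      (Proj.basicOpen (grading n R) (X k)).topIso.inv =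
      (Scheme.ΓSpecIso _).inv ≫ e.hom.appTop := by
    rw [h, Iso.inv_hom_id_assoc]
  have h3 : e.hom.appTop ≫ e.inv.appTop = 𝟙 _ := by
    rw [← Scheme.Hom.comp_appTop, Iso.inv_hom_id]
    rfl
  rw [h1]
  exact (congrArg (· ≫ e.inv.appTop) h2).trans ((Category.assoc _ _ _).trans
    ((congrArg ((Scheme.ΓSpecIso _).inv ≫ ·) h3).trans (Category.comp_id _)))

/-- The affine scheme `V(𝔞)` in a chart, as a scheme over `ℙⁿ`. -/
abbrev affineι (k : Fin (n + 1)) (𝔞 : Ideal (ChartRing n R k)) :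
    Spec (.of (ChartRing n R k ⧸ 𝔞)) ⟶ ProjectiveSpace n R :=
  Spec.map (CommRingCat.ofHom (Ideal.Quotient.mk 𝔞)) ≫ chartι k

instance (k : Fin (n + 1)) (𝔞 : Ideal (ChartRing n R k)) : QuasiCompact (affineι k 𝔞) := by
  infer_instance

theorem affineι_preimage (k : Fin (n + 1)) (𝔞 : Ideal (ChartRing n R k)) :
    affineι (R := R) k 𝔞 ⁻¹ᵁ (chart k).1 = ⊤ :=
  congrArg (Spec.map (CommRingCat.ofHom (Ideal.Quotient.mk 𝔞)) ⁻¹ᵁ ·) (chartι_preimage k)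

theorem awayToSection_affineι (k : Fin (n + 1)) (𝔞 : Ideal (ChartRing n R k)) :
    Proj.awayToSection (grading n R) (X k) ≫
      (affineι (R := R) k 𝔞).appLE (chart k).1 ⊤ (affineι_preimage k 𝔞).ge =
    CommRingCat.ofHom (Ideal.Quotient.mk 𝔞) ≫ (Scheme.ΓSpecIso _).inv := by
  rw [Scheme.ΓSpecIso_inv_naturality, ← awayToSection_chartι k, Category.assoc]
  congr 1

theorem appLE_chartEquiv (k : Fin (n + 1)) (𝔞 : Ideal (ChartRing n R k)) (a : ChartRing n R k) :
    ((affineι (R := R) k 𝔞).appLE (chart k).1 ⊤ (affineι_preimage k 𝔞).ge).hom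
      (chartEquiv k a) = (Scheme.ΓSpecIso _).inv.hom (Ideal.Quotient.mk 𝔞 a) :=
  congr($(awayToSection_affineι k 𝔞).hom a)

theorem appLE_chartEquiv_eq_zero_iff (k : Fin (n + 1)) (𝔞 : Ideal (ChartRing n R k))
    (a : ChartRing n R k) :
    ((affineι (R := R) k 𝔞).appLE (chart k).1 ⊤ (affineι_preimage k 𝔞).ge).hom
      (chartEquiv k a) = 0 ↔ a ∈ 𝔞 := by
  rw [appLE_chartEquiv, ← Ideal.Quotient.eq_zero_iff_mem]
  exact map_eq_zero_iff _
    (Scheme.ΓSpecIso (.of (ChartRing n R k ⧸ 𝔞))).symm.commRingCatIsoToRingEquiv.injective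

/-- The source of `affineι k 𝔞` lies entirely over D₊(xₖ), so pulling back from D₊(xⱼ) factors
through the overlap, where f/xⱼᵈ is a multiple of f/xₖᵈ. -/
theorem toChart_mem_ker_affineι (k j : Fin (n + 1)) (𝔞 : Ideal (ChartRing n R k))
    {d : ℕ} {f : MvPolynomial (Fin (n + 1)) R} (hf : f.IsHomogeneous d)
    (h : dehomogenize k f ∈ 𝔞) : toChart j f ∈ (affineι k 𝔞).ker.ideal (chart j) := by
  rw [Scheme.Hom.ker_apply, RingHom.mem_ker, Scheme.Hom.app_eq_appLE]
  let W := (chart (R := R) k).1 ⊓ (chart j).1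
  let V := affineι k 𝔞 ⁻¹ᵁ (chart j).1
  have hV : V ≤ affineι k 𝔞 ⁻¹ᵁ W := le_inf (le_top.trans (affineι_preimage k 𝔞).ge) le_rfl
  have h1 : ∀ a, ((affineι k 𝔞).appLE (chart j).1 V le_rfl).hom a =
      ((affineι k 𝔞).appLE W V hV).hom (res inf_le_right a) := fun a =>
    congr($(Scheme.Hom.map_appLE (affineι k 𝔞) hV
      (homOfLE (inf_le_right : W ≤ (chart j).1)).op).hom a).symm
  have h2 : ∀ a, ((affineι k 𝔞).appLE W V hV).hom (res inf_le_left a) =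
      ((Spec (.of (ChartRing n R k ⧸ 𝔞))).presheaf.map (homOfLE (le_top : V ≤ ⊤)).op).hom
      (((affineι (R := R) k 𝔞).appLE (chart k).1 ⊤ (affineι_preimage k 𝔞).ge).hom a) := fun a =>
    congr($((Scheme.Hom.map_appLE (affineι k 𝔞) hV
      (homOfLE (inf_le_left : W ≤ (chart k).1)).op).trans
      (Scheme.Hom.appLE_map (affineι k 𝔞) (affineι_preimage k 𝔞).ge
      (homOfLE (le_top : V ≤ ⊤)).op).symm).hom a)
  refine (h1 _).trans ?_
  rw [res_toChart k j hf (inf_le_left : W ≤ _) (inf_le_right : W ≤ _), map_mul, h2, toChart_apply,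
    (appLE_chartEquiv_eq_zero_iff k 𝔞 _).mpr h, map_zero, zero_mul]

theorem chartEquiv_mem_ker_affineι_iff (k : Fin (n + 1)) (𝔞 : Ideal (ChartRing n R k))
    (a : ChartRing n R k) : chartEquiv k a ∈ (affineι k 𝔞).ker.ideal (chart k) ↔ a ∈ 𝔞 := by
  constructor
  · intro h
    rw [Scheme.Hom.ker_apply, RingHom.mem_ker] at h
    rw [← appLE_chartEquiv_eq_zero_iff k 𝔞 a, Scheme.Hom.appLE, CommRingCat.hom_comp,
      RingHom.comp_apply, h, map_zero]
  · intro h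
    obtain ⟨d, f, hf, rfl⟩ := dehomogenize_surjective k a
    exact toChart_mem_ker_affineι k k 𝔞 hf h

end Closure

end

/-! ### Integral subschemes have prime homogeneous ideals -/

section

open CategoryTheory Opposite

universe u

/-- The scheme-theoretic image of an integral scheme is integral. -/
theorem isIntegral_image {W Y : Scheme.{u}} (g : W ⟶ Y) [QuasiCompact g] [IsIntegral W] :
    IsIntegral g.ker.subscheme := by
  change IsIntegral (Scheme.Hom.image g)
  have : IsSchemeTheoreticallyDominant (Scheme.Hom.toImage g) := by
    constructor
    refine Scheme.IdealSheafData.ext_of_iSup_eq_top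
      (fun U : Y.affineOpens => ⟨Scheme.Hom.imageι g ⁻¹ᵁ U.1, U.2.preimage _⟩) ?_ fun U => ?_
    · have := iSup_affineOpens_eq_top Y
      rw [← Scheme.Hom.preimage_iSup, this]
      rfl
    · rw [Scheme.Hom.ker_apply, (RingHom.injective_iff_ker_eq_bot _).mp
        (Scheme.Hom.toImage_app_injective g U)]
      rfl
  have := IsSchemeTheoreticallyDominant.isReduced (Scheme.Hom.toImage g)
  have : IrreducibleSpace (Scheme.Hom.image g) := by
    rw [irreducibleSpace_def]
    convert! ((IrreducibleSpace.isIrreducible_univ W).image _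
      (Scheme.Hom.toImage g).continuous.continuousOn).closure
    simpa using (Scheme.Hom.toImage g).denseRange.closure_range.symm
  exact isIntegral_of_irreducibleSpace_of_isReduced _

section

variable {n : ℕ} {R : Type u} [CommRing R]

theorem toChart_mem_ideal_iff (Y : ClosedSubscheme n R) (k : Fin (n + 1))
    (a : Γ(ProjectiveSpace n R, (chart k).1)) :
    a ∈ Y.ideal (chart k) ↔ (Y.subschemeι.app (chart k).1).hom a = 0 := by
  rw [← RingHom.mem_ker, Scheme.IdealSheafData.ker_subschemeι_app]

theorem nonempty_of_not_mem (Y : ClosedSubscheme n R) {k : Fin (n + 1)}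
    {a : Γ(ProjectiveSpace n R, (chart k).1)} (h : a ∉ Y.ideal (chart k)) :
    Nonempty (Y.subschemeι ⁻¹ᵁ (chart k).1 : Y.subscheme.Opens) := by
  by_contra hne
  rw [toChart_mem_ideal_iff] at h
  have : Y.subschemeι ⁻¹ᵁ (chart k).1 = ⊥ := by
    ext x
    simpa using fun hx => hne ⟨⟨x, hx⟩⟩
  have hsub : ∀ V : Y.subscheme.Opens, V = ⊥ → Subsingleton Γ(Y.subscheme, V) := by
    rintro _ rfl
    infer_instance
  have := hsub _ this
  exact h (Subsingleton.elim _ _)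

/-- If both charts meet `Y`, so does their overlap by irreducibility, and restriction from chart `j`
to it is injective on an integral scheme. If chart `j` misses `Y`, there is nothing to check. -/
theorem toChart_mem_ideal_of_mem (Y : ClosedSubscheme n R) [IsIntegral Y.subscheme]
    (k j : Fin (n + 1)) (hk : Nonempty (Y.subschemeι ⁻¹ᵁ (chart k).1 : Y.subscheme.Opens)) {d : ℕ}
    {f : MvPolynomial (Fin (n + 1)) R} (hf : f.IsHomogeneous d)
    (h : toChart k f ∈ Y.ideal (chart k)) : toChart j f ∈ Y.ideal (chart j) := by
  by_contra hj
  have hj' := nonempty_of_not_mem Y hj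
  rw [toChart_mem_ideal_iff] at h hj
  apply hj
  let W := (chart (R := R) k).1 ⊓ (chart j).1
  have hW : Nonempty (Y.subschemeι ⁻¹ᵁ W : Y.subscheme.Opens) := by
    obtain ⟨x, hx⟩ := nonempty_preirreducible_inter (Y.subschemeι ⁻¹ᵁ (chart k).1).isOpen
      (Y.subschemeι ⁻¹ᵁ (chart j).1).isOpen ⟨hk.some.1, hk.some.2⟩ ⟨hj'.some.1, hj'.some.2⟩
    exact ⟨⟨x, hx⟩⟩
  have hl : ∀ a, (Y.subschemeι.app W).hom (res inf_le_left a) =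
      (Y.subscheme.presheaf.map (homOfLE (Y.subschemeι.preimage_mono
        (inf_le_left : W ≤ (chart k).1))).op).hom ((Y.subschemeι.app (chart k).1).hom a) := fun a =>
    congr($(Scheme.Hom.naturality Y.subschemeι (homOfLE (inf_le_left : W ≤ (chart k).1)).op).hom a)
  have hr : ∀ a, (Y.subschemeι.app W).hom (res inf_le_right a) =
      (Y.subscheme.presheaf.map (homOfLE (Y.subschemeι.preimage_mono
        (inf_le_right : W ≤ (chart j).1))).op).hom
        ((Y.subschemeι.app (chart j).1).hom a) := fun a =>
    congr($(Scheme.Hom.naturality Y.subschemeι (homOfLE (inf_le_right : W ≤ (chart j).1)).op).hom a)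
  apply map_injective_of_isIntegral Y.subscheme (homOfLE (Y.subschemeι.preimage_mono
    (inf_le_right : W ≤ (chart j).1)))
  refine (hr _).symm.trans ?_
  rw [res_toChart k j hf (inf_le_left : W ≤ _) (inf_le_right : W ≤ _), map_mul, hl, h, map_zero,
    zero_mul]
  exact (map_zero _).symm

theorem isPrime_homogeneousIdeal (Y : ClosedSubscheme n R) [IsIntegral Y.subscheme] :
    (homogeneousIdeal Y).toIdeal.IsPrime := by
  refine Ideal.IsHomogeneous.isPrime_of_homogeneous_mem_or_mem (𝒜 := grading n R)
    (homogeneousIdeal Y).isHomogeneous ?_ ?_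
  · intro htop
    obtain ⟨x⟩ := IsIntegral.nonempty (X := Y.subscheme)
    have hx : Y.subschemeι x ∈ ⨆ k, (chart (n := n) (R := R) k).1 := by
      rw [iSup_chart]; trivial
    obtain ⟨k, hk⟩ := TopologicalSpace.Opens.mem_iSup.mp hx
    have h1 : (1 : MvPolynomial (Fin (n + 1)) R) ∈ (homogeneousIdeal Y).toIdeal := by
      rw [htop]; trivial
    have h2 := (mem_homogeneousIdeal_iff Y (isHomogeneous_one _ _)).mp h1 k
    rw [toChart_mem_ideal_iff, map_one, map_one] at h2
    have : Nonempty (Y.subschemeι ⁻¹ᵁ (chart k).1 : Y.subscheme.Opens) := ⟨⟨x, hk⟩⟩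
    exact one_ne_zero h2
  · rintro f g ⟨d, hf⟩ ⟨e, hg⟩ hfg
    have hf' : f.IsHomogeneous d := hf
    have hg' : g.IsHomogeneous e := hg
    by_contra! hne
    rw [mem_homogeneousIdeal_iff Y hf', mem_homogeneousIdeal_iff Y hg', not_forall] at hne
    obtain ⟨⟨k, hk⟩, hng⟩ := hne
    -- Since `f` is nonzero on chart `k`, this chart meets `Y` and its functions on `Y` form a
    -- domain. So `g` vanishes there, hence on every chart.
    have hV := nonempty_of_not_mem Y hk
    have h1 := (mem_homogeneousIdeal_iff Y (hf'.mul hg')).mp hfg k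
    rw [toChart_mem_ideal_iff, map_mul, map_mul] at h1
    rcases mul_eq_zero.mp h1 with h | h
    · exact hk ((toChart_mem_ideal_iff Y k _).mpr h)
    · exact hng fun j => toChart_mem_ideal_of_mem Y k j hV hg' ((toChart_mem_ideal_iff Y k _).mpr h)

end

end

/-! ### Zero schemes of homogeneous ideals -/

section

open CategoryTheory Opposite

universe u

variable {n : ℕ} {R : Type u} [CommRing R]

/-- The closure in `ℙⁿ` of the zero locus in a chart of an ideal of polynomials. -/
abbrev chartClosure (J : Ideal (MvPolynomial (Fin (n + 1)) R)) (k : Fin (n + 1)) :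
    ClosedSubscheme n R := (affineι k (J.map (dehomogenize k))).ker

theorem toChart_mem_chartClosure_iff {J : Ideal (MvPolynomial (Fin (n + 1)) R)}
    (k : Fin (n + 1)) (f : MvPolynomial (Fin (n + 1)) R) :
    toChart k f ∈ (chartClosure J k).ideal (chart k) ↔ toChart k f ∈ J.map (toChart k) := by
  rw [toChart_apply, chartEquiv_mem_ker_affineι_iff, map_toChart]
  constructor
  · exact Ideal.mem_map_of_mem _
  · intro h
    obtain ⟨b, hb, hbf⟩ := (Ideal.mem_map_iff_of_surjective _ (chartEquiv k).surjective).mp h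
    rwa [← (chartEquiv k).injective hbf]

theorem chartClosure_ideal_self (J : Ideal (MvPolynomial (Fin (n + 1)) R)) (k : Fin (n + 1)) :
    (chartClosure J k).ideal (chart k) = J.map (toChart k) := by
  ext a
  obtain ⟨d, f, -, rfl⟩ := toChart_surjective k a
  exact toChart_mem_chartClosure_iff k f

theorem IsGraded.le_of_isHomogeneous {I J : Ideal (MvPolynomial (Fin (n + 1)) R)}
    (hI : IsGraded I) (h : ∀ (d : ℕ) (f : MvPolynomial (Fin (n + 1)) R), f.IsHomogeneous d →
      f ∈ I → f ∈ J) : I ≤ J := by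
  intro f hf
  rw [← sum_homogeneousComponent f]
  exact J.sum_mem fun d _ => h d _ (homogeneousComponent_isHomogeneous d f) (hI f hf d)

section

variable {s : Set (MvPolynomial (Fin (n + 1)) R)} (hs : IsGraded (Ideal.span s))

include hs

/-- An infimum of ideal sheaves is a union of subschemes: the zero scheme is the union of the
closures of its affine pieces. This gives its ideal on each chart without gluing ideals by hand. -/
theorem zeroScheme_eq_iInf : zeroScheme s = ⨅ k, chartClosure (Ideal.span s) k := by
  apply le_antisymm
  · refine le_iInf fun k => sInf_le ?_
    refine Ideal.span_le.mp (hs.le_of_isHomogeneous fun d f hf hfJ => ?_)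
    exact (mem_homogeneousIdeal_iff _ hf).mpr fun j =>
      toChart_mem_ker_affineι k j _ hf (Ideal.mem_map_of_mem _ hfJ)
  · refine le_sInf fun Y hY => ?_
    refine Scheme.IdealSheafData.le_of_iSup_eq_top (chart (n := n) (R := R)) iSup_chart fun k => ?_
    refine (iInf_le (chartClosure (Ideal.span s)) k (chart k)).trans ?_
    rw [chartClosure_ideal_self]
    refine Ideal.map_le_iff_le_comap.mpr (hs.le_of_isHomogeneous fun d f hf hfJ => ?_)
    exact (mem_homogeneousIdeal_iff Y hf).mp (Ideal.span_le.mpr hY hfJ) k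

theorem zeroScheme_ideal (k : Fin (n + 1)) :
    (zeroScheme s).ideal (chart k) = (Ideal.span s).map (toChart k) := by
  rw [zeroScheme_eq_iInf hs]
  apply le_antisymm
  · refine (iInf_le (chartClosure (Ideal.span s)) k (chart k)).trans ?_
    rw [chartClosure_ideal_self]
  · rw [Scheme.IdealSheafData.ideal_iInf]
    refine Ideal.map_le_iff_le_comap.mpr (hs.le_of_isHomogeneous fun d f hf hfJ => ?_)
    rw [Ideal.mem_comap, iInf_apply, Ideal.mem_iInf]
    exact fun j => toChart_mem_ker_affineι j k _ hf (Ideal.mem_map_of_mem _ hfJ)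

/-- The homogeneous ideal of `V₊(s)` is the saturation of the ideal generated by `s`. -/
theorem homogeneousIdeal_zeroScheme :
    (homogeneousIdeal (zeroScheme s)).toIdeal = sat (Ideal.span s) := by
  have key : ∀ (d : ℕ) (f : MvPolynomial (Fin (n + 1)) R), f.IsHomogeneous d →
      (f ∈ (homogeneousIdeal (zeroScheme s)).toIdeal ↔ f ∈ sat (Ideal.span s)) := by
    intro d f hf
    rw [mem_homogeneousIdeal_iff _ hf, mem_sat]
    refine forall_congr' fun k => ?_
    rw [zeroScheme_ideal hs, toChart_mem_map_iff hs k hf]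
  exact le_antisymm
    ((isGraded_toIdeal _).le_of_isHomogeneous fun d f hf => (key d f hf).mp)
    (hs.sat.le_of_isHomogeneous fun d f hf => (key d f hf).mpr)

/-- For a prime ideal without `X k`, powers of `X k` can be cancelled, so a form vanishing on the
piece in chart `k` already lies in the ideal, up to powers of the variable of the chart under test.
-/
theorem zeroScheme_eq_chartClosure (hp : (Ideal.span s).IsPrime) {k : Fin (n + 1)}
    (hk : X k ∉ Ideal.span s) : zeroScheme s = chartClosure (Ideal.span s) k := by
  refine Scheme.IdealSheafData.ext_of_iSup_eq_top (chart (n := n) (R := R)) iSup_chart fun j => ?_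
  rw [zeroScheme_ideal hs]
  ext a
  obtain ⟨d, f, hf, rfl⟩ := toChart_surjective j a
  rw [toChart_mem_map_iff hs j hf]
  constructor
  · rintro ⟨N, hN⟩
    have := toChart_mem_ker_affineι k j _ ((isHomogeneous_X_pow j N).mul hf)
      (Ideal.mem_map_of_mem _ hN)
    rwa [map_mul, map_pow, toChart_X_self, one_pow, one_mul] at this
  · intro h
    obtain ⟨N, hN⟩ := exists_toChart_pow_mul_mem _ j k hf h
    rw [toChart_mem_chartClosure_iff,
      toChart_mem_map_iff hs k ((isHomogeneous_X_pow j N).mul hf)] at hN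
    obtain ⟨M, hM⟩ := hN
    exact ⟨N, (hp.mem_or_mem hM).resolve_left fun h => hk (hp.mem_of_pow_mem M h)⟩

theorem isIntegral_zeroScheme (hp : (Ideal.span s).IsPrime) (hsat : IsSaturated (Ideal.span s)) :
    IsIntegral (zeroScheme s).subscheme := by
  -- Saturation excludes the irrelevant prime, whose zero scheme is empty: if all variables were in
  -- the ideal, so would be 1.
  obtain ⟨k, hk⟩ : ∃ k : Fin (n + 1), X k ∉ Ideal.span s := by
    by_contra! h
    exact hp.ne_top ((Ideal.eq_top_iff_one _).mpr (hsat 1 fun k => by rw [mul_one]; exact h k))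
  rw [zeroScheme_eq_chartClosure hs hp hk]
  have : ((Ideal.span s).map (dehomogenize k)).IsPrime := by
    have key : ∀ (d : ℕ) (f : MvPolynomial (Fin (n + 1)) R), f.IsHomogeneous d →
        (dehomogenize k f ∈ (Ideal.span s).map (dehomogenize k) ↔ f ∈ Ideal.span s) := by
      intro d f hf
      rw [dehomogenize_mem_map_iff hs k hf]
      exact ⟨fun ⟨N, hN⟩ => (hp.mem_or_mem hN).resolve_left fun h => hk (hp.mem_of_pow_mem N h),
        fun h => ⟨0, by rwa [pow_zero, one_mul]⟩⟩
    constructor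
    · rw [Ne, Ideal.eq_top_iff_one, ← map_one (dehomogenize k), key 0 1 (isHomogeneous_one _ _)]
      exact fun h => hp.ne_top ((Ideal.eq_top_iff_one _).mpr h)
    · intro a b hab
      obtain ⟨d, f, hf, rfl⟩ := dehomogenize_surjective k a
      obtain ⟨e, g, hg, rfl⟩ := dehomogenize_surjective k b
      rw [← map_mul, key _ _ (hf.mul hg)] at hab
      rw [key _ _ hf, key _ _ hg]
      exact hp.mem_or_mem hab
  exact isIntegral_image _

end

theorem eventually_hilbertFunction_zeroScheme {K : Type u} [Field K]
    {s : Set (MvPolynomial (Fin (n + 1)) K)} (hs : IsGraded (Ideal.span s)) :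
    ∀ᶠ d in Filter.atTop, hilbertFunction (zeroScheme s) d = hilb (Ideal.span s) d := by
  obtain ⟨D, hD⟩ := exists_forall_mem_of_mem_sat hs
  filter_upwards [Filter.eventually_ge_atTop D] with d hd
  change hilb (homogeneousIdeal (zeroScheme s)).toIdeal d = _
  rw [homogeneousIdeal_zeroScheme hs]
  exact hilb_congr fun f hf => ⟨hD d hd f hf, fun h => le_sat _ h⟩

end

end UltraHilb

end

/-! ### The two transfer statements -/

theorem mainTheorem6 {S : Type*} (U : Ultrafilter S) (F : S → Type*) [∀ i, Field (F i)]
    (n : ℕ) (P : Polynomial ℚ) :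
    (∀ (X : UltraHilb.ClosedSubscheme n (UltraHilb.Ultraproduct U F))
        (Y : ∀ i, UltraHilb.ClosedSubscheme n (F i)),
        UltraHilb.HasHilbertPolynomial X P → UltraHilb.IsRepresentative U X Y →
        ∀ᶠ i in (U : Filter S), UltraHilb.HasHilbertPolynomial (Y i) P) ∧
    (∀ Y : ∀ i, UltraHilb.ClosedSubscheme n (F i),
        (∀ᶠ i in (U : Filter S), UltraHilb.HasHilbertPolynomial (Y i) P) →
        UltraHilb.HasHilbertPolynomial (UltraHilb.ultraproductScheme U Y) P ∧
        ((∀ᶠ i in (U : Filter S), AlgebraicGeometry.IsIntegral (Y i).subscheme) →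
          AlgebraicGeometry.IsIntegral (UltraHilb.ultraproductScheme U Y).subscheme)) := by
  open UltraHilb in
  refine ⟨?_, fun Y hY => ?_⟩
  · rintro X Y hX ⟨r, d, g, hg, rfl, hY⟩
    let _ : Field (Ultraproduct U F) := Ideal.Quotient.field _
    have hX' : ∀ᶠ e in Filter.atTop,
        hilbertFunction (zeroScheme (Set.range fun j => map (ultraMk U F) (g j))) e =
          hilb (Ideal.span (Set.range fun j => map (ultraMk U F) (g j))) e :=
      eventually_hilbertFunction_zeroScheme (isGraded_span (by
        rintro _ ⟨j, rfl⟩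
        exact ⟨d j, (hg j).map _⟩))
    filter_upwards [eventually_forall_hilb_span_eq U F g fun j => ⟨d j, hg j⟩] with i hi
    have hY' := eventually_hilbertFunction_zeroScheme (K := F i)
      (s := Set.range fun j => map (Pi.evalRingHom F i) (g j)) (isGraded_span (by
        rintro _ ⟨j, rfl⟩
        exact ⟨d j, (hg j).map _⟩))
    rw [hY i]
    filter_upwards [hX, hX', hY'] with e h1 h2 h3
    rw [h3, hi e, ← h2, h1]
  · let _ : Field (Ultraproduct U F) := Ideal.Quotient.field _
    let J := ultraproductIdeal U fun i => homogeneousIdeal (Y i)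
    have hspan : Ideal.span (J.toIdeal : Set (MvPolynomial (Fin (n + 1)) (Ultraproduct U F))) =
        J.toIdeal := Ideal.span_eq _
    have hgr : IsGraded (Ideal.span
        (J.toIdeal : Set (MvPolynomial (Fin (n + 1)) (Ultraproduct U F)))) := by
      rw [hspan]; exact isGraded_toIdeal J
    have hsat : IsSaturated (Ideal.span
        (J.toIdeal : Set (MvPolynomial (Fin (n + 1)) (Ultraproduct U F)))) := by
      rw [hspan]; exact isSaturated_ultraproductIdeal U fun i => isSaturated_homogeneousIdeal (Y i)
    constructor
    · obtain ⟨e, he⟩ := exists_uniform_hilb_bound (Fin (n + 1)) P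
      refine Filter.eventually_atTop.mpr ⟨e, fun d hd => ?_⟩
      have hd' : ∀ i, HasHilbertPolynomial (Y i) P →
          (hilb (homogeneousIdeal (Y i)).toIdeal d : ℚ) = P.eval (d : ℚ) := fun i hi =>
        he (F i) _ (isGraded_toIdeal _) (isSaturated_homogeneousIdeal (Y i)) hi d hd
      -- One index suffices for each `d`, and it may depend on `d`, because `e` was fixed
      -- independently of the index.
      obtain ⟨i, hi, hi'⟩ :=
        (hY.and (eventually_hilb_eq U (fun i => homogeneousIdeal (Y i)) d)).exists
      change (hilb (homogeneousIdeal (zeroScheme _)).toIdeal d : ℚ) = _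
      rw [homogeneousIdeal_zeroScheme hgr, hsat.sat_eq, hspan, ← hi', hd' i hi]
    · intro hint
      refine isIntegral_zeroScheme hgr ?_ hsat
      rw [hspan]
      refine isPrime_ultraproductIdeal U ?_
      filter_upwards [hint] with i hi
      exact isPrime_homogeneousIdeal (Y i)
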